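/- Let $X$ be a non-empty locally compact Hausdorff space with Borel $\sigma$-algebra $\mathscr B$, and let $E$ be a Banach lattice with order continuous norm (i.e. $x_\alpha\downarrow 0$ in $E$ implies $\|x_\alpha\|\downarrow 0$). Let $\overline{E^+}=E^+\cup\{\infty\}$ be the extended positive cone of $E$, where $x\le\infty$ and $x+\infty=\infty+x=\infty$ for all $x\in\overline{E^+}$, $0\cdot\infty=0$, and $r\cdot\infty=\infty$ for real $r>0$. An $\overline{E^+}$-valued measure is a map $\mu:\mathscr B\to\overline{E^+}$ with $\mu(\emptyset)=0$ and $\mu(\bigcup_{n}\Delta_n)=\sup_{N}\sum_{n=1}^N\mu(\Delta_n)$ in $\overline{E^+}$ for every pairwise disjoint sequence $(\Delta_n)_{n\ge1}$ in $\mathscr B$. It is a regular Borel measure if $\mu(K)\in E$ for all compact $K$, $\mu(V)=\sup\{\mu(K):K\subseteq V,\ K\text{ compact}\}$ for all open $V$, and $\mu(\Delta)=\inf\{\mu(V):V\supseteq\Delta,\ V\text{ open}\}$ for all $\Delta\in\mathscr B$. Let $M$ be the set of all $\overline{E^+}$-valued regular Borel measures on $X$ (such a measure may be infinite, i.e. $\mu(X)=\infty$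 is allowed), which is a cone under the setwise addition and multiplication by non-negative reals, ordered setwise: $\mu\le\nu$ if and only if $\mu(\Delta)\le\nu(\Delta)$ for all $\Delta\in\mathscr B$. The order integral with respect to $\mu$ of an elementary function $\varphi=\sum_{i=1}^n r_i\chi_{\Delta_i}$ ($r_i\ge0$, $\Delta_i\in\mathscr B$) is $\int\varphi\,d\mu=\sum_{i=1}^n r_i\mu(\Delta_i)\in\overline{E^+}$; for measurable $f:X\to[0,\infty]$ one sets $\int f\,d\mu=\sup_n\int\varphi_n\,d\mu$ for any sequence of elementary functions $\varphi_n\uparrow f$ pointwise; and for measurable $f:X\to\mathbb R$ with $\int f^+\,d\mu$ and $\int f^-\,d\mu$ finite one sets $\int f\,d\mu=\int f^+\,d\mu-\int f^-\,d\mu\in E$. Let $C_c(X)$ be the vector lattice of real-valued continuous functions on $X$ with compact support, let $L_r(C_c(X),E)$ be the space of regular operators, i.e. of differences of two positive linear maps $C_c(X)\to E$, ordered by $S\le T$ if and only if $Sf\le Tf$ for all $f\ge0$, and let $L_r(C_c(X),E)^+$ be its cone of positive elements. Then: (1) For every $\mu\in M$, the integral $I_\mu(f)=\int f\,d\mu\in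 E$ exists for all $f\in C_c(X)$, and $I_\mu\in L_r(C_c(X),E)^+$. The map $I:M\to L_r(C_c(X),E)^+$, $\mu\mapsto I_\mu$, is a bijection that is additive and positively homogeneous, and $I_\mu\le I_\nu$ if and only if $\mu\le\nu$. (2) For every $T\in L_r(C_c(X),E)$ there exist $\mu_1,\mu_2\in M$ such that $T(f)=I_{\mu_1}(f)-I_{\mu_2}(f)$ for all $f\in C_c(X)$. -/

import Mathlib

open Set MeasureTheory
open scoped NNReal ENNReal CompactlySupported
set_option linter.unusedSectionVars false

/-- The norm of a Banach lattice `E` is order continuous: `x_α ↓ 0` implies `‖x_α‖ ↓ 0`.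
Decreasing nets are represented by their ranges, i.e. by non-empty downward directed sets. -/
def IsOrderContinuousNorm (E : Type*) [NormedAddCommGroup E] [Lattice E] : Prop :=
  ∀ D : Set E, D.Nonempty → DirectedOn (fun x y => y ≤ x) D → IsGLB D 0 →
    ∀ ε : ℝ, 0 < ε → ∃ x ∈ D, ‖x‖ < ε

/-! ### The extended positive cone -/

/-- The positive cone `E₊` of `E`. -/
def PosCone (E : Type*) [AddCommGroup E] [PartialOrder E] : Type _ := {x : E // 0 ≤ x}

namespace PosCone

variable {E : Type*} [AddCommGroup E] [PartialOrder E]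

/-- The element of `E₊` given by a positive element of `E`. -/
def mk (x : E) (hx : 0 ≤ x) : PosCone E := ⟨x, hx⟩

instance instPartialOrder : PartialOrder (PosCone E) :=
  inferInstanceAs (PartialOrder {x : E // 0 ≤ x})

instance instAddCommMonoid [IsOrderedAddMonoid E] : AddCommMonoid (PosCone E) :=
  inferInstanceAs (AddCommMonoid {x : E // 0 ≤ x})

instance instIsOrderedAddMonoid [IsOrderedAddMonoid E] : IsOrderedAddMonoid (PosCone E) :=
  inferInstanceAs (IsOrderedAddMonoid {x : E // 0 ≤ x})

instance instModule [IsOrderedAddMonoid E] [Module ℝ E] [IsOrderedModule ℝ E] :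
    Module ℝ≥0 (PosCone E) where
  smul r x := ⟨(r : ℝ) • x.1, smul_nonneg r.2 x.2⟩
  one_smul x := Subtype.ext (one_smul ℝ x.1)
  mul_smul r s x := Subtype.ext (mul_smul (r : ℝ) (s : ℝ) x.1)
  smul_zero r := Subtype.ext (smul_zero (r : ℝ))
  smul_add r x y := Subtype.ext (smul_add (r : ℝ) x.1 y.1)
  add_smul r s x := Subtype.ext (add_smul (r : ℝ) (s : ℝ) x.1)
  zero_smul x := Subtype.ext (zero_smul ℝ x.1)

end PosCone

/-- The extended positive cone `E₊ ∪ {∞}`, with `x ≤ ∞` and `x + ∞ = ∞ + x = ∞` for all `x`. -/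
abbrev ExtPosCone (E : Type*) [AddCommGroup E] [PartialOrder E] : Type _ := WithTop (PosCone E)

namespace ExtPosCone

section Action

variable {E : Type*} [AddCommGroup E] [PartialOrder E] [IsOrderedAddMonoid E] [Module ℝ E]
  [IsOrderedModule ℝ E]

/-- The action of the non-negative reals on `E₊ ∪ {∞}`: `0 • ∞ = 0`, and `r • ∞ = ∞` if `r > 0`. -/
noncomputable instance instSMul : SMul ℝ≥0 (ExtPosCone E) where
  smul r x := if r = 0 then 0 else WithTop.map (r • ·) x

theorem zero_smul' (x : ExtPosCone E) : (0 : ℝ≥0) • x = 0 := if_pos rfl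

theorem smul_top {r : ℝ≥0} (hr : r ≠ 0) : r • (⊤ : ExtPosCone E) = ⊤ := if_neg hr

theorem smul_coe (r : ℝ≥0) (x : PosCone E) :
    r • (x : ExtPosCone E) = ((r • x : PosCone E) : ExtPosCone E) := by
  by_cases hr : r = 0
  · subst hr
    rw [zero_smul', zero_smul]; rfl
  · exact if_neg hr

noncomputable instance instModule : Module ℝ≥0 (ExtPosCone E) where
  one_smul x := by
    induction x using WithTop.recTopCoe with
    | top => exact smul_top one_ne_zero
    | coe x => rw [smul_coe, one_smul]
  mul_smul r s x := by
    by_cases hr : r = 0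
    · subst hr; simp only [zero_mul, zero_smul']
    by_cases hs : s = 0
    · subst hs
      rw [mul_zero, zero_smul', ← WithTop.coe_zero, smul_coe, smul_zero]
    induction x using WithTop.recTopCoe with
    | top => rw [smul_top hs, smul_top hr, smul_top (mul_ne_zero hr hs)]
    | coe x => rw [smul_coe, smul_coe, smul_coe, mul_smul]
  smul_zero r := by rw [← WithTop.coe_zero, smul_coe, smul_zero]
  smul_add r x y := by
    by_cases hr : r = 0
    · subst hr; simp only [zero_smul', add_zero]
    induction x using WithTop.recTopCoe with
    | top => rw [WithTop.top_add, smul_top hr, WithTop.top_add]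
    | coe x =>
      induction y using WithTop.recTopCoe with
      | top => rw [WithTop.add_top, smul_top hr, WithTop.add_top]
      | coe y => rw [← WithTop.coe_add, smul_coe, smul_coe, smul_coe, ← WithTop.coe_add, smul_add]
  add_smul r s x := by
    by_cases hr : r = 0
    · subst hr; simp only [zero_smul', zero_add]
    by_cases hs : s = 0
    · subst hs; simp only [zero_smul', add_zero]
    induction x using WithTop.recTopCoe with
    | top => rw [smul_top hr, smul_top hs, smul_top (by simp [hr]), WithTop.top_add]
    | coe x => rw [smul_coe, smul_coe, smul_coe, ← WithTop.coe_add, add_smul]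
  zero_smul := zero_smul'

theorem smul_mono (r : ℝ≥0) {x y : ExtPosCone E} (h : x ≤ y) : r • x ≤ r • y := by
  by_cases hr : r = 0
  · subst hr; simp only [zero_smul', le_refl]
  induction y using WithTop.recTopCoe with
  | top => rw [smul_top hr]; exact le_top
  | coe y =>
    induction x using WithTop.recTopCoe with
    | top => exact absurd h (by simp)
    | coe x =>
      rw [smul_coe, smul_coe]
      rw [WithTop.coe_le_coe] at h ⊢
      exact show (r : ℝ) • x.1 ≤ (r : ℝ) • y.1 from
        smul_le_smul_of_nonneg_left (show x.1 ≤ y.1 from h) r.2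

theorem isLUB_smul (r : ℝ≥0) {ι : Type*} [Nonempty ι] {f : ι → ExtPosCone E} {a : ExtPosCone E}
    (h : IsLUB (range f) a) : IsLUB (range fun i => r • f i) (r • a) := by
  by_cases hr : r = 0
  · subst hr; simp only [zero_smul', range_const]; exact isLUB_singleton
  refine ⟨?_, fun c hc => ?_⟩
  · rintro _ ⟨i, rfl⟩; exact smul_mono r (h.1 ⟨i, rfl⟩)
  · have : a ≤ r⁻¹ • c := h.2 (by
      rintro _ ⟨i, rfl⟩
      have := smul_mono r⁻¹ (hc ⟨i, rfl⟩)
      simpa only [smul_smul, inv_mul_cancel₀ hr, one_smul] using this)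
    have := smul_mono r this
    simpa only [smul_smul, mul_inv_cancel₀ hr, one_smul] using this

theorem isGLB_smul (r : ℝ≥0) {ι : Type*} [Nonempty ι] {f : ι → ExtPosCone E} {a : ExtPosCone E}
    (h : IsGLB (range f) a) : IsGLB (range fun i => r • f i) (r • a) := by
  by_cases hr : r = 0
  · subst hr; simp only [zero_smul', range_const]; exact isGLB_singleton
  refine ⟨?_, fun c hc => ?_⟩
  · rintro _ ⟨i, rfl⟩; exact smul_mono r (h.1 ⟨i, rfl⟩)
  · have : r⁻¹ • c ≤ a := h.2 (by
      rintro _ ⟨i, rfl⟩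
      have := smul_mono r⁻¹ (hc ⟨i, rfl⟩)
      simpa only [smul_smul, inv_mul_cancel₀ hr, one_smul] using this)
    have := smul_mono r this
    simpa only [smul_smul, mul_inv_cancel₀ hr, one_smul] using this

end Action

section Order

variable {E : Type*} [AddCommGroup E] [Lattice E] [IsOrderedAddMonoid E]

theorem add_mono {x y z w : ExtPosCone E} (h : x ≤ y) (h' : z ≤ w) : x + z ≤ y + w := by
  induction y using WithTop.recTopCoe with
  | top => rw [WithTop.top_add]; exact le_top
  | coe y =>
    induction w using WithTop.recTopCoe with
    | top => rw [WithTop.add_top]; exact le_top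
    | coe w =>
      lift x to PosCone E using ne_top_of_le_ne_top WithTop.coe_ne_top h
      lift z to PosCone E using ne_top_of_le_ne_top WithTop.coe_ne_top h'
      rw [WithTop.coe_le_coe] at h h'
      rw [← WithTop.coe_add, ← WithTop.coe_add, WithTop.coe_le_coe]
      exact add_le_add (show x.1 ≤ y.1 from h) (show z.1 ≤ w.1 from h')

theorem zero_le' (x : ExtPosCone E) : 0 ≤ x := by
  induction x using WithTop.recTopCoe with
  | top => exact le_top
  | coe x => exact WithTop.coe_le_coe.2 x.2

theorem add_le_of_isLUB {ι : Type*} [Nonempty ι] {f : ι → ExtPosCone E} {a y c : ExtPosCone E}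
    (h : IsLUB (range f) a) (hc : ∀ i, f i + y ≤ c) : a + y ≤ c := by
  induction c using WithTop.recTopCoe with
  | top => exact le_top
  | coe c =>
    have hy : y ≠ ⊤ := by
      rintro rfl
      have := hc (Classical.arbitrary ι)
      simp at this
    lift y to PosCone E using hy
    have hyc : y.1 ≤ c.1 := by
      have := (add_mono (zero_le' (f (Classical.arbitrary ι))) le_rfl).trans
        (hc (Classical.arbitrary ι))
      rw [zero_add, WithTop.coe_le_coe] at this
      exact this
    have ha : a ≤ (PosCone.mk (c.1 - y.1) (sub_nonneg.2 hyc) : ExtPosCone E) := h.2 (by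
      rintro _ ⟨i, rfl⟩
      have hi := hc i
      have hf : f i ≠ ⊤ := by
        intro hf; rw [hf] at hi; simp at hi
      lift f i to PosCone E using hf with z
      rw [← WithTop.coe_add, WithTop.coe_le_coe] at hi
      rw [WithTop.coe_le_coe]
      exact le_sub_iff_add_le.2 (show z.1 + y.1 ≤ c.1 from hi))
    lift a to PosCone E using ne_top_of_le_ne_top WithTop.coe_ne_top ha
    rw [WithTop.coe_le_coe] at ha
    rw [← WithTop.coe_add, WithTop.coe_le_coe]
    exact le_sub_iff_add_le.1 (show a.1 ≤ c.1 - y.1 from ha)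

theorem le_add_of_isGLB {ι : Type*} {f : ι → ExtPosCone E} {a y c : ExtPosCone E}
    (h : IsGLB (range f) a) (hc : ∀ i, c ≤ f i + y) : c ≤ a + y := by
  induction y using WithTop.recTopCoe with
  | top => rw [WithTop.add_top]; exact le_top
  | coe y =>
    induction c using WithTop.recTopCoe with
    | top =>
      have : ⊤ ≤ a := h.2 (by
        rintro _ ⟨i, rfl⟩
        have hi := hc i
        by_contra hf
        lift f i to PosCone E using (fun h' => hf (by rw [h'])) with z
        rw [← WithTop.coe_add] at hi
        simp at hi)
      rw [top_le_iff.1 this, WithTop.top_add]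
    | coe c =>
      have ha : (PosCone.mk ((c.1 - y.1) ⊔ 0) le_sup_right : ExtPosCone E) ≤ a :=
        h.2 (by
          rintro _ ⟨i, rfl⟩
          have hi := hc i
          generalize f i = z at hi
          induction z using WithTop.recTopCoe with
          | top => exact le_top
          | coe z =>
            rw [← WithTop.coe_add, WithTop.coe_le_coe] at hi
            rw [WithTop.coe_le_coe]
            exact sup_le (sub_le_iff_le_add.2 (show c.1 ≤ z.1 + y.1 from hi)) z.2)
      refine le_trans ?_ (add_mono ha le_rfl)
      rw [← WithTop.coe_add, WithTop.coe_le_coe]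
      exact sub_le_iff_le_add.1 (le_sup_left : c.1 - y.1 ≤ (c.1 - y.1) ⊔ 0)

/-- Suprema of upward directed families add up. -/
theorem isLUB_add {ι : Type*} [Nonempty ι] {f g : ι → ExtPosCone E} {a b : ExtPosCone E}
    (hfg : ∀ i j, ∃ k, f i ≤ f k ∧ g j ≤ g k)
    (hf : IsLUB (range f) a) (hg : IsLUB (range g) b) :
    IsLUB (range fun i => f i + g i) (a + b) := by
  refine ⟨?_, fun c hc => add_le_of_isLUB hf fun i => ?_⟩
  · rintro _ ⟨i, rfl⟩; exact add_mono (hf.1 ⟨i, rfl⟩) (hg.1 ⟨i, rfl⟩)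
  · rw [add_comm]
    refine add_le_of_isLUB hg fun j => ?_
    obtain ⟨k, hk, hk'⟩ := hfg i j
    rw [add_comm]
    exact (add_mono hk hk').trans (hc ⟨k, rfl⟩)

/-- Infima of downward directed families add up. -/
theorem isGLB_add {ι : Type*} {f g : ι → ExtPosCone E} {a b : ExtPosCone E}
    (hfg : ∀ i j, ∃ k, f k ≤ f i ∧ g k ≤ g j)
    (hf : IsGLB (range f) a) (hg : IsGLB (range g) b) :
    IsGLB (range fun i => f i + g i) (a + b) := by
  refine ⟨?_, fun c hc => le_add_of_isGLB hf fun i => ?_⟩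
  · rintro _ ⟨i, rfl⟩; exact add_mono (hf.1 ⟨i, rfl⟩) (hg.1 ⟨i, rfl⟩)
  · rw [add_comm]
    refine le_add_of_isGLB hg fun j => ?_
    obtain ⟨k, hk, hk'⟩ := hfg i j
    rw [add_comm]
    exact (hc ⟨k, rfl⟩ : c ≤ f k + g k).trans (add_mono hk hk')

end Order

end ExtPosCone

/-! ### Measures with values in the extended positive cone -/

/-- A measure on the measurable space `X` with values in the extended positive cone of `E`.
As for Mathlib's `VectorMeasure`, it is represented by a function on all subsets of `X` that
has the value `0` at the non-measurable ones. -/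
structure ExtMeasure (X E : Type*) [MeasurableSpace X] [AddCommGroup E] [Lattice E]
    [IsOrderedAddMonoid E] where
  toFun : Set X → ExtPosCone E
  not_measurable' : ∀ s, ¬MeasurableSet s → toFun s = 0
  empty' : toFun ∅ = 0
  iUnion' : ∀ s : ℕ → Set X, (∀ n, MeasurableSet (s n)) → Pairwise (Function.onFun Disjoint s) →
    IsLUB (range fun N : ℕ => ∑ n ∈ Finset.range N, toFun (s n)) (toFun (⋃ n, s n))

namespace ExtMeasure

section Basic

variable {X E : Type*} [MeasurableSpace X] [AddCommGroup E] [Lattice E] [IsOrderedAddMonoid E]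

instance instFunLike : FunLike (ExtMeasure X E) (Set X) (ExtPosCone E) where
  coe := toFun
  coe_injective μ ν h := by cases μ; cases ν; congr

/-- `μ ≤ ν` when `μ s ≤ ν s` for all measurable `s`. -/
instance instPartialOrder : PartialOrder (ExtMeasure X E) where
  le μ ν := ∀ s, MeasurableSet s → μ s ≤ ν s
  le_refl _ _ _ := le_rfl
  le_trans _ _ _ h h' s hs := (h s hs).trans (h' s hs)
  le_antisymm μ ν h h' := DFunLike.ext _ _ fun s => by
    by_cases hs : MeasurableSet s
    · exact le_antisymm (h s hs) (h' s hs)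
    · exact (μ.not_measurable' s hs).trans (ν.not_measurable' s hs).symm

theorem partialSum_mono (μ : ExtMeasure X E) (s : ℕ → Set X) :
    Monotone fun N : ℕ => ∑ n ∈ Finset.range N, μ (s n) :=
  monotone_nat_of_le_succ fun N => by
    rw [Finset.sum_range_succ]
    have := ExtPosCone.add_mono (le_refl (∑ n ∈ Finset.range N, μ (s n)))
      (ExtPosCone.zero_le' (μ (s N)))
    rwa [add_zero] at this

theorem mono (μ : ExtMeasure X E) {s t : Set X} (hs : MeasurableSet s) (ht : MeasurableSet t)
    (hst : s ⊆ t) : μ s ≤ μ t := by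
  let u : ℕ → Set X := fun n => if n = 0 then s else if n = 1 then t \ s else ∅
  have hu : ∀ n, MeasurableSet (u n) := by
    intro n
    by_cases h0 : n = 0
    · simp only [u, h0, if_true]; exact hs
    by_cases h1 : n = 1
    · simp only [u, h1]; exact ht.diff hs
    · simp only [u, h0, h1, if_false]; exact MeasurableSet.empty
  have hd : Pairwise (Function.onFun Disjoint u) := by
    intro m n hmn
    refine Set.disjoint_left.2 fun x hm hn => ?_
    simp only [u] at hm hn
    split_ifs at hm hn <;> simp_all
  have hU : ⋃ n, u n = t := by
    ext x
    rw [mem_iUnion]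
    constructor
    · rintro ⟨n, hn⟩
      simp only [u] at hn
      split_ifs at hn
      · exact hst hn
      · exact hn.1
      · exact hn.elim
    · intro hx
      by_cases hxs : x ∈ s
      · exact ⟨0, by simpa [u] using hxs⟩
      · exact ⟨1, by simpa [u] using ⟨hx, hxs⟩⟩
  have h := (μ.iUnion' u hu hd).1 ⟨1, rfl⟩
  rw [hU] at h
  have e : ∑ n ∈ Finset.range 1, μ.toFun (u n) = μ.toFun s := by simp [u]
  change ∑ n ∈ Finset.range 1, μ.toFun (u n) ≤ μ t at h
  rw [e] at h
  exact h

instance instZero : Zero (ExtMeasure X E) where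
  zero :=
    { toFun := fun _ => 0
      not_measurable' := fun _ _ => rfl
      empty' := rfl
      iUnion' := fun s _ _ => by
        simp only [Finset.sum_const_zero, range_const]; exact isLUB_singleton }

/-- `(μ + ν) s = μ s + ν s`. -/
instance instAdd : Add (ExtMeasure X E) where
  add μ ν :=
    { toFun := fun s => μ s + ν s
      not_measurable' := fun s hs => by
        rw [show μ s = 0 from μ.not_measurable' s hs, show ν s = 0 from ν.not_measurable' s hs,
          add_zero]
      empty' := by
        rw [show μ ∅ = 0 from μ.empty', show ν ∅ = 0 from ν.empty', add_zero]
      iUnion' := fun s hs hd => by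
        simp only [Finset.sum_add_distrib]
        exact ExtPosCone.isLUB_add (fun i j => ⟨max i j, partialSum_mono μ s (le_max_left i j),
          partialSum_mono ν s (le_max_right i j)⟩) (μ.iUnion' s hs hd) (ν.iUnion' s hs hd) }

end Basic

section Cone

variable {X E : Type*} [MeasurableSpace X] [AddCommGroup E] [Lattice E] [IsOrderedAddMonoid E]
  [Module ℝ E] [IsOrderedModule ℝ E]

/-- `(r • μ) s = r • μ s`. -/
noncomputable instance instSMul : SMul ℝ≥0 (ExtMeasure X E) where
  smul r μ :=
    { toFun := fun s => r • μ s
      not_measurable' := fun s hs => by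
        rw [show μ s = 0 from μ.not_measurable' s hs, smul_zero]
      empty' := by rw [show μ ∅ = 0 from μ.empty', smul_zero]
      iUnion' := fun s hs hd => by
        simp only [← Finset.smul_sum]
        exact ExtPosCone.isLUB_smul r (μ.iUnion' s hs hd) }

/-- The measures form a cone. -/
noncomputable instance instAddCommMonoid : AddCommMonoid (ExtMeasure X E) where
  add_assoc _ _ _ := DFunLike.ext _ _ fun _ => add_assoc _ _ _
  zero_add _ := DFunLike.ext _ _ fun _ => zero_add _
  add_zero _ := DFunLike.ext _ _ fun _ => add_zero _
  add_comm _ _ := DFunLike.ext _ _ fun _ => add_comm _ _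
  nsmul := nsmulRec

noncomputable instance instModule : Module ℝ≥0 (ExtMeasure X E) where
  one_smul _ := DFunLike.ext _ _ fun _ => one_smul _ _
  mul_smul _ _ _ := DFunLike.ext _ _ fun _ => mul_smul _ _ _
  smul_zero _ := DFunLike.ext _ _ fun _ => smul_zero _
  smul_add _ _ _ := DFunLike.ext _ _ fun _ => smul_add _ _ _
  add_smul _ _ _ := DFunLike.ext _ _ fun _ => add_smul _ _ _
  zero_smul _ := DFunLike.ext _ _ fun _ => zero_smul _ _

end Cone

/-! ### Regularity -/

section Regularity

variable {X E : Type*} [TopologicalSpace X] [MeasurableSpace X] [AddCommGroup E] [Lattice E]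
  [IsOrderedAddMonoid E]

/-- `μ` is finite on the compact sets. -/
def IsBorel (μ : ExtMeasure X E) : Prop :=
  ∀ K : Set X, IsCompact K → μ K ≠ ⊤

/-- `μ s = sup {μ K : K compact, K ⊆ s}`. -/
def InnerRegularAt (μ : ExtMeasure X E) (s : Set X) : Prop :=
  IsLUB (range fun K : {K : Set X // IsCompact K ∧ K ⊆ s} => μ K) (μ s)

/-- `μ s = inf {μ V : V open, s ⊆ V}`. -/
def OuterRegularAt (μ : ExtMeasure X E) (s : Set X) : Prop :=
  IsGLB (range fun V : {V : Set X // IsOpen V ∧ s ⊆ V} => μ V) (μ s)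

/-- `μ` is a regular Borel measure: it is finite on compact sets, inner regular at all open sets,
and outer regular at all Borel sets. -/
structure IsRegularBorel (μ : ExtMeasure X E) : Prop where
  isBorel : μ.IsBorel
  innerRegular : ∀ V : Set X, IsOpen V → μ.InnerRegularAt V
  outerRegular : ∀ s : Set X, MeasurableSet s → μ.OuterRegularAt s

end Regularity

/-! ### The order integral -/

section Integral

variable {X E : Type*} [MeasurableSpace X] [AddCommGroup E] [Lattice E] [IsOrderedAddMonoid E]
  [Module ℝ E] [IsOrderedModule ℝ E]

/-- The order integral `∑ r • μ (φ = r)` of an elementary function `φ`. -/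
noncomputable def elemIntegral (μ : ExtMeasure X E) (φ : SimpleFunc X ℝ≥0) : ExtPosCone E :=
  ∑ r ∈ φ.range, r • μ (φ ⁻¹' {r})

/-- `a` is the order integral of the measurable function `f : X → [0, ∞]` with respect to `μ`:
for any choice of a sequence of elementary functions `φ n` that increases pointwise to `f`,
`a` is the supremum of the integrals of the `φ n`. -/
def HasPosIntegral (μ : ExtMeasure X E) (f : X → ℝ≥0∞) (a : ExtPosCone E) : Prop :=
  Measurable f ∧ ∀ φ : ℕ → SimpleFunc X ℝ≥0, Monotone φ →
    (∀ x, ⨆ n, (φ n x : ℝ≥0∞) = f x) → IsLUB (range fun n => μ.elemIntegral (φ n)) a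

/-- `e` is the order integral of the measurable function `f : X → ℝ` with respect to `μ`:
the integrals of the positive part `f⁺` and of the negative part `f⁻` are finite, and `e` is their
difference. -/
def HasIntegral (μ : ExtMeasure X E) (f : X → ℝ) (e : E) : Prop :=
  Measurable f ∧ ∃ a b : PosCone E,
    μ.HasPosIntegral (fun x => ENNReal.ofReal (f x)) a ∧
    μ.HasPosIntegral (fun x => ENNReal.ofReal (-f x)) b ∧ e = a.1 - b.1

end Integral

end ExtMeasure

/-- The cone of regular Borel measures on `X` with values in the extended positive cone of `E`,
as a subcone of the cone of all measures. -/
noncomputable def regularBorelMeasures (X E : Type*) [TopologicalSpace X] [T2Space X]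
    [MeasurableSpace X] [BorelSpace X] [AddCommGroup E] [Lattice E] [IsOrderedAddMonoid E]
    [Module ℝ E] [IsOrderedModule ℝ E] : Submodule ℝ≥0 (ExtMeasure X E) where
  carrier := {μ | μ.IsRegularBorel}
  zero_mem' :=
    { isBorel := fun _ _ => WithTop.zero_ne_top
      innerRegular := fun V _ => by
        have : Nonempty {K : Set X // IsCompact K ∧ K ⊆ V} := ⟨∅, isCompact_empty, empty_subset V⟩
        change IsLUB (range fun _ => (0 : ExtPosCone E)) 0
        rw [range_const]; exact isLUB_singleton
      outerRegular := fun s _ => by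
        have : Nonempty {V : Set X // IsOpen V ∧ s ⊆ V} := ⟨univ, isOpen_univ, subset_univ s⟩
        change IsGLB (range fun _ => (0 : ExtPosCone E)) 0
        rw [range_const]; exact isGLB_singleton }
  add_mem' := fun {μ ν} hμ hν =>
    { isBorel := fun K hK => WithTop.add_ne_top.2 ⟨hμ.isBorel K hK, hν.isBorel K hK⟩
      innerRegular := fun V hV => by
        have : Nonempty {K : Set X // IsCompact K ∧ K ⊆ V} := ⟨∅, isCompact_empty, empty_subset V⟩
        refine ExtPosCone.isLUB_add (fun K L => ⟨⟨K ∪ L, K.2.1.union L.2.1,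
          union_subset K.2.2 L.2.2⟩, ?_, ?_⟩) (hμ.innerRegular V hV) (hν.innerRegular V hV)
        · exact μ.mono K.2.1.measurableSet (K.2.1.union L.2.1).measurableSet subset_union_left
        · exact ν.mono L.2.1.measurableSet (K.2.1.union L.2.1).measurableSet subset_union_right
      outerRegular := fun s hs => by
        refine ExtPosCone.isGLB_add (fun V W => ⟨⟨V ∩ W, V.2.1.inter W.2.1,
          subset_inter V.2.2 W.2.2⟩, ?_, ?_⟩) (hμ.outerRegular s hs) (hν.outerRegular s hs)
        · exact μ.mono (V.2.1.inter W.2.1).measurableSet V.2.1.measurableSet inter_subset_left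
        · exact ν.mono (V.2.1.inter W.2.1).measurableSet W.2.1.measurableSet inter_subset_right }
  smul_mem' := fun r μ hμ =>
    { isBorel := fun K hK => by
        have h := hμ.isBorel K hK
        change r • μ K ≠ ⊤
        lift μ K to PosCone E using h with z
        rw [ExtPosCone.smul_coe]; exact WithTop.coe_ne_top
      innerRegular := fun V hV => by
        have : Nonempty {K : Set X // IsCompact K ∧ K ⊆ V} := ⟨∅, isCompact_empty, empty_subset V⟩
        exact ExtPosCone.isLUB_smul r (hμ.innerRegular V hV)
      outerRegular := fun s hs => by
        have : Nonempty {V : Set X // IsOpen V ∧ s ⊆ V} := ⟨univ, isOpen_univ, subset_univ s⟩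
        exact ExtPosCone.isGLB_smul r (hμ.outerRegular s hs) }

/-! ### Regular operators -/

section Operators

variable (F G : Type*) [AddCommGroup F] [Lattice F] [IsOrderedAddMonoid F] [Module ℝ F]
  [AddCommGroup G] [Lattice G] [IsOrderedAddMonoid G] [Module ℝ G] [IsOrderedModule ℝ G]

/-- The regular operators between vector lattices: the linear maps that are the difference of two
positive ones. -/
def regularOperators : Submodule ℝ (F →ₗ[ℝ] G) where
  carrier := {T | ∃ S₁ S₂ : F →ₗ[ℝ] G, (∀ f, 0 ≤ f → 0 ≤ S₁ f) ∧ (∀ f, 0 ≤ f → 0 ≤ S₂ f) ∧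
    T = S₁ - S₂}
  zero_mem' := ⟨0, 0, fun _ _ => le_rfl, fun _ _ => le_rfl, (sub_zero _).symm⟩
  add_mem' := by
    rintro _ _ ⟨S₁, S₂, h₁, h₂, rfl⟩ ⟨R₁, R₂, k₁, k₂, rfl⟩
    exact ⟨S₁ + R₁, S₂ + R₂, fun f hf => add_nonneg (h₁ f hf) (k₁ f hf),
      fun f hf => add_nonneg (h₂ f hf) (k₂ f hf), by abel⟩
  smul_mem' := by
    rintro c _ ⟨S₁, S₂, h₁, h₂, rfl⟩
    rcases le_total 0 c with hc | hc
    · exact ⟨c • S₁, c • S₂, fun f hf => smul_nonneg hc (h₁ f hf),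
        fun f hf => smul_nonneg hc (h₂ f hf), smul_sub _ _ _⟩
    · refine ⟨(-c) • S₂, (-c) • S₁, fun f hf => smul_nonneg (neg_nonneg.2 hc) (h₂ f hf),
        fun f hf => smul_nonneg (neg_nonneg.2 hc) (h₁ f hf), ?_⟩
      rw [← smul_sub, neg_smul, ← smul_neg, neg_sub]

/-- `S ≤ T` when `S f ≤ T f` for all `f ≥ 0`. -/
instance regularOperators.instPartialOrder : PartialOrder (regularOperators F G) where
  le S T := ∀ f : F, 0 ≤ f → S.1 f ≤ T.1 f
  le_refl _ _ _ := le_rfl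
  le_trans _ _ _ h h' f hf := (h f hf).trans (h' f hf)
  le_antisymm S T h h' := by
    have key : ∀ f : F, 0 ≤ f → S.1 f = T.1 f := fun f hf => le_antisymm (h f hf) (h' f hf)
    refine Subtype.ext (LinearMap.ext fun f => ?_)
    rw [← posPart_sub_negPart f, map_sub, map_sub, key _ (posPart_nonneg f),
      key _ (negPart_nonneg f)]

/-- The cone of positive regular operators. -/
def positiveRegularOperators : Submodule ℝ≥0 (regularOperators F G) where
  carrier := {T | 0 ≤ T}
  zero_mem' := le_refl (0 : regularOperators F G)
  add_mem' := fun hS hT f hf => add_nonneg (hS f hf) (hT f hf)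
  smul_mem' := fun r _ hT f hf => smul_nonneg r.2 (hT f hf)

end Operators

open Filter Topology

/-! ### Order continuity of the norm: Dedekind completeness and positive functionals -/

section BanachLattice

variable {E : Type*} [NormedAddCommGroup E] [Lattice E] [IsOrderedAddMonoid E] [HasSolidNorm E]

/-! Everything is reduced to the scalar Riesz–Markov–Kakutani theorem by means of the positive
continuous functionals `φ` on `E`. By Hahn–Banach they determine the order of `E`. Order continuity
of the norm yields suprema and infima of order bounded directed sets in `E`, and makes every `φ`
preserve them.

For positive `T`, each `φ ∘ T` has a Riesz measure `m_φ`, and the task is to find `μ s` in `E` with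
`φ (μ s) = m_φ s` for all `φ` at once. For open `V` on which `T` is order bounded, this is the
supremum of `T f` over the continuous `0 ≤ f ≤ 1` with compact support in `V`. For a set contained
in such a `V` it is the infimum of the values at open supersets. All other Borel sets get `∞`.
Identities and inequalities then come from the `m_φ`; the real difficulty is finiteness, since a
bound on each `m_φ s` separately does not give a bound in `E`. The decisive case is
`isFiniteOn_iUnion`: bounded partial sums of values force the union to have finite value, because
open supersets can be chosen with norm errors that are summable.

Conversely, a measure that is finite on compact sets gives finite scalar measures `s ↦ φ (μ (s ∩
K))`. Monotone convergence for these shows that the order integral exists, does not depend on the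
approximating sequence, and satisfies `φ (∫ f dμ) = ∫ f dμ_φ`; linearity, positivity and additivity
in `μ` follow.

The order of the measures is recovered from `μ K ≤ ∫ f dμ ≤ ∫ f dν ≤ ν W`, with a Urysohn function
`f` between `K` and `W`, together with regularity. This gives injectivity as well. Since a regular
operator is a difference of two positive ones, the second assertion follows from surjectivity. -/

theorem norm_le_norm_of_nonneg_of_le {x y : E} (hx : 0 ≤ x) (hxy : x ≤ y) : ‖x‖ ≤ ‖y‖ :=
  norm_le_norm_of_abs_le_abs (by rwa [abs_of_nonneg hx, abs_of_nonneg (hx.trans hxy)])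

/-- If the norm is order continuous, then a downward directed set contains elements that are
arbitrarily close in norm to its infimum. -/
theorem IsOrderContinuousNorm.exists_norm_sub_lt_of_isGLB (hE : IsOrderContinuousNorm E)
    {D : Set E} (hne : D.Nonempty) (hD : DirectedOn (fun x y => y ≤ x) D) {a : E}
    (ha : IsGLB D a) {ε : ℝ} (hε : 0 < ε) : ∃ x ∈ D, ‖x - a‖ < ε := by
  obtain ⟨_, ⟨x, hx, rfl⟩, h⟩ := hE ((fun x => x - a) '' D) (hne.image _)
    (by
      rintro _ ⟨x, hx, rfl⟩ _ ⟨y, hy, rfl⟩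
      obtain ⟨z, hz, hzx, hzy⟩ := hD x hx y hy
      exact ⟨_, ⟨z, hz, rfl⟩, sub_le_sub_right hzx a, sub_le_sub_right hzy a⟩)
    (by
      refine ⟨?_, fun c hc => ?_⟩
      · rintro _ ⟨x, hx, rfl⟩; exact sub_nonneg.2 (ha.1 hx)
      · have : c + a ≤ a := ha.2 fun x hx => le_sub_iff_add_le.1 (hc ⟨x, hx, rfl⟩)
        simpa using this) ε hε
  exact ⟨x, hx, h⟩

variable [NormedSpace ℝ E] [IsOrderedModule ℝ E]

/-- The Archimedean property: `w` is below `b / (n + 1)`, which tends to `0` in norm, and the order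
is closed. -/
theorem nonpos_of_forall_nsmul_le {w b : E} (h : ∀ n : ℕ, n • w ≤ b) : w ≤ 0 := by
  have ht : Tendsto (fun n : ℕ => ((n : ℝ) + 1)⁻¹ • b) atTop (𝓝 ((0 : ℝ) • b)) := by
    refine Tendsto.smul_const ?_ b
    simpa [one_div] using tendsto_one_div_add_atTop_nhds_zero_nat (𝕜 := ℝ)
  rw [zero_smul] at ht
  refine ge_of_tendsto' ht fun n => ?_
  have hn : (0 : ℝ) < (n : ℝ) + 1 := by positivity
  have h1 : ((n : ℝ) + 1) • w ≤ b := by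
    have := h (n + 1)
    rwa [← Nat.cast_smul_eq_nsmul ℝ, Nat.cast_succ] at this
  have h2 := smul_le_smul_of_nonneg_left h1 (inv_nonneg.2 hn.le)
  rwa [smul_smul, inv_mul_cancel₀ hn.ne', one_smul] at h2

/-- A Banach lattice with order continuous norm is Dedekind complete. -/
theorem IsOrderContinuousNorm.exists_isLUB [CompleteSpace E] (hE : IsOrderContinuousNorm E)
    {D : Set E} (hne : D.Nonempty) (hD : DirectedOn (· ≤ ·) D) (hb : BddAbove D) :
    ∃ a, IsLUB D a := by
  obtain ⟨d₀, hd₀⟩ := hne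
  obtain ⟨u₀, hu₀⟩ := hb
  -- If `w` is below all gaps `u - d`, then subtracting `w` from an upper bound gives an upper bound
  -- again. Iterating, `n • w ≤ u₀ - d₀` for all `n`, so the Archimedean property applies.
  have hGLB : IsGLB (Set.image2 (fun u d => u - d) (upperBounds D) D) 0 := by
    refine ⟨?_, fun w hw => ?_⟩
    · rintro _ ⟨u, hu, d, hd, rfl⟩; exact sub_nonneg.2 (hu hd)
    · have key : ∀ n : ℕ, u₀ - n • w ∈ upperBounds D := by
        intro n
        induction n with
        | zero => simpa using hu₀
        | succ n ih =>
          intro d hd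
          have := hw ⟨_, ih, d, hd, rfl⟩
          rw [succ_nsmul, ← sub_sub]
          exact le_sub_comm.1 this
      exact nonpos_of_forall_nsmul_le fun n => le_sub_comm.1 (key n hd₀)
  have hsmall := hE (Set.image2 (fun u d => u - d) (upperBounds D) D)
    ⟨u₀ - d₀, u₀, hu₀, d₀, hd₀, rfl⟩ (by
    rintro _ ⟨u, hu, d, hd, rfl⟩ _ ⟨u', hu', d', hd', rfl⟩
    obtain ⟨d'', hd'', h1, h2⟩ := hD d hd d' hd'
    exact ⟨_, ⟨u ⊓ u', fun x hx => le_inf (hu hx) (hu' hx), d'', hd'', rfl⟩,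
      sub_le_sub inf_le_left h1, sub_le_sub inf_le_right h2⟩) hGLB
  have : Nonempty D := ⟨⟨d₀, hd₀⟩⟩
  have : IsDirectedOrder D := ⟨fun x y => by
    obtain ⟨z, hz, h1, h2⟩ := hD x.1 x.2 y.1 y.2
    exact ⟨⟨z, hz⟩, h1, h2⟩⟩
  -- A gap `u - d` of small norm controls the whole tail: `0 ≤ x - d ≤ u - d` for `x ≥ d` in `D`.
  -- The limit of the increasing net is its supremum.
  have hC : CauchySeq (fun d : D => (d : E)) := by
    refine Metric.cauchy_iff.2 ⟨map_neBot, fun ε hε => ?_⟩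
    obtain ⟨_, ⟨u, hu, d, hd, rfl⟩, h⟩ := hsmall (ε / 2) (half_pos hε)
    have key : ∀ x : D, (⟨d, hd⟩ : D) ≤ x → dist (x : E) d < ε / 2 := fun x hx => by
      rw [dist_eq_norm]
      exact (norm_le_norm_of_nonneg_of_le (sub_nonneg.2 hx)
        (sub_le_sub_right (hu x.2) d)).trans_lt h
    refine ⟨_, image_mem_map (mem_atTop (⟨d, hd⟩ : D)), ?_⟩
    rintro _ ⟨x, hx, rfl⟩ _ ⟨y, hy, rfl⟩
    exact (dist_triangle_right _ _ d).trans_lt (by linarith [key x hx, key y hy])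
  obtain ⟨a, ha⟩ := cauchySeq_tendsto_of_complete hC
  have := isLUB_of_tendsto_atTop (Subtype.mono_coe (· ∈ D)) ha
  rw [Subtype.range_coe] at this
  exact ⟨a, this⟩

theorem IsOrderContinuousNorm.exists_isGLB [CompleteSpace E] (hE : IsOrderContinuousNorm E)
    {D : Set E} (hne : D.Nonempty) (hD : DirectedOn (fun x y => y ≤ x) D) (hb : BddBelow D) :
    ∃ a, IsGLB D a := by
  obtain ⟨a, ha⟩ := hE.exists_isLUB (D := -D) hne.neg (by
    intro x hx y hy
    obtain ⟨z, hz, h1, h2⟩ := hD _ hx _ hy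
    exact ⟨-z, by simpa using hz, le_neg_of_le_neg h1, le_neg_of_le_neg h2⟩) hb.neg
  exact ⟨-a, by rw [← neg_neg D]; exact ha.neg⟩

theorem IsOrderContinuousNorm.exists_norm_sub_lt_of_isLUB (hE : IsOrderContinuousNorm E)
    {D : Set E} (hne : D.Nonempty) (hD : DirectedOn (· ≤ ·) D) {a : E}
    (ha : IsLUB D a) {ε : ℝ} (hε : 0 < ε) : ∃ x ∈ D, ‖a - x‖ < ε := by
  obtain ⟨x, hx, h⟩ := hE.exists_norm_sub_lt_of_isGLB (D := -D) hne.neg (by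
    intro x hx y hy
    obtain ⟨z, hz, h1, h2⟩ := hD _ hx _ hy
    exact ⟨-z, by simpa using hz, neg_le.1 h1, neg_le.1 h2⟩) ha.neg hε
  exact ⟨-x, hx, by rwa [sub_neg_eq_add, add_comm, ← sub_neg_eq_add]⟩

variable (E) in
/-- The positive continuous linear functionals. -/
abbrev PosDual : Type _ := {φ : E →L[ℝ] ℝ // ∀ x, 0 ≤ x → 0 ≤ φ x}

namespace PosDual

theorem mono (φ : PosDual E) {x y : E} (h : x ≤ y) : φ.1 x ≤ φ.1 y := by
  have := φ.2 _ (sub_nonneg.2 h)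
  rwa [map_sub, sub_nonneg] at this

/-- The order of a Banach lattice is determined by the positive functionals. -/
theorem le_of_forall_le {x y : E} (h : ∀ φ : PosDual E, φ.1 x ≤ φ.1 y) : x ≤ y := by
  by_contra hxy
  -- The positive cone is closed and convex, so a point `y - x` outside it is separated from it by a
  -- continuous functional, which is then positive.
  let C : ProperCone ℝ E :=
    { carrier := {x : E | 0 ≤ x}
      add_mem' := fun ha hb => add_nonneg ha hb
      zero_mem' := le_refl (0 : E)
      smul_mem' := fun c x hx => smul_nonneg c.2 hx
      isClosed' := isClosed_nonneg }
  obtain ⟨f, hf, hf'⟩ := C.hyperplane_separation_point (x₀ := y - x)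
    fun h' => hxy (sub_nonneg.1 h')
  have := h ⟨f, fun x hx => hf x hx⟩
  rw [map_sub] at hf'
  exact absurd this (not_le.2 (by linarith))

theorem eq_of_forall_eq {x y : E} (h : ∀ φ : PosDual E, φ.1 x = φ.1 y) : x = y :=
  le_antisymm (le_of_forall_le fun φ => (h φ).le) (le_of_forall_le fun φ => (h φ).ge)

theorem exists_abs_sub_lt (φ : PosDual E) {D : Set E} {a : E}
    (h : ∀ ε : ℝ, 0 < ε → ∃ x ∈ D, ‖a - x‖ < ε) {ε : ℝ} (hε : 0 < ε) :
    ∃ x ∈ D, |φ.1 a - φ.1 x| < ε := by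
  -- The summand `1` covers the case `φ = 0`.
  obtain ⟨x, hx, hn⟩ := h (ε / (‖φ.1‖ + 1)) (by positivity)
  refine ⟨x, hx, ?_⟩
  rw [← map_sub, ← Real.norm_eq_abs]
  calc ‖φ.1 (a - x)‖ ≤ ‖φ.1‖ * ‖a - x‖ := φ.1.le_opNorm _
    _ ≤ (‖φ.1‖ + 1) * ‖a - x‖ := by gcongr; linarith
    _ < (‖φ.1‖ + 1) * (ε / (‖φ.1‖ + 1)) := by gcongr
    _ = ε := by field_simp

/-- Positive functionals preserve suprema of upward directed sets. -/
theorem isLUB_image (hE : IsOrderContinuousNorm E) (φ : PosDual E) {D : Set E} (hne : D.Nonempty)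
    (hD : DirectedOn (· ≤ ·) D) {a : E} (ha : IsLUB D a) : IsLUB (φ.1 '' D) (φ.1 a) := by
  refine ⟨?_, fun c hc => le_of_forall_pos_le_add fun ε hε => ?_⟩
  · rintro _ ⟨x, hx, rfl⟩; exact φ.mono (ha.1 hx)
  · obtain ⟨x, hx, h⟩ := exists_abs_sub_lt φ
      (fun ε hε => hE.exists_norm_sub_lt_of_isLUB hne hD ha hε) hε
    have := hc ⟨x, hx, rfl⟩
    linarith [le_abs_self (φ.1 a - φ.1 x)]

/-- Positive functionals preserve infima of downward directed sets. -/
theorem isGLB_image (hE : IsOrderContinuousNorm E) (φ : PosDual E) {D : Set E} (hne : D.Nonempty)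
    (hD : DirectedOn (fun x y => y ≤ x) D) {a : E} (ha : IsGLB D a) :
    IsGLB (φ.1 '' D) (φ.1 a) := by
  refine ⟨?_, fun c hc => le_of_forall_pos_le_add fun ε hε => ?_⟩
  · rintro _ ⟨x, hx, rfl⟩; exact φ.mono (ha.1 hx)
  · obtain ⟨x, hx, h⟩ := exists_abs_sub_lt φ (D := D) (a := a)
      (fun ε hε => by
        obtain ⟨x, hx, h⟩ := hE.exists_norm_sub_lt_of_isGLB hne hD ha hε
        exact ⟨x, hx, by rwa [norm_sub_rev]⟩) hε
    have := hc ⟨x, hx, rfl⟩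
    linarith [neg_abs_le (φ.1 a - φ.1 x)]

end PosDual

end BanachLattice

/-! ### Passage between `E`, its positive cone and the extended cone -/

namespace PosCone

variable {E : Type*} [AddCommGroup E] [PartialOrder E]

theorem val_nonneg (x : PosCone E) : 0 ≤ x.1 := x.2

theorem val_le_val_of_coe_le_coe {x y : PosCone E} (h : (x : ExtPosCone E) ≤ y) : x.1 ≤ y.1 :=
  show x ≤ y from WithTop.coe_le_coe.1 h

variable [IsOrderedAddMonoid E]

theorem coe_sum_val {ι : Type*} (x : ι → PosCone E) (s : Finset ι) :
    (∑ n ∈ s, x n).1 = ∑ n ∈ s, (x n).1 :=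
  map_sum (⟨⟨Subtype.val, rfl⟩, fun _ _ => rfl⟩ : PosCone E →+ E) x s

theorem coe_sum_withTop {ι : Type*} (x : ι → PosCone E) (s : Finset ι) :
    ∑ n ∈ s, (x n : ExtPosCone E) = ((∑ n ∈ s, x n : PosCone E) : ExtPosCone E) :=
  (map_sum (⟨⟨WithTop.some, rfl⟩, fun _ _ => rfl⟩ : PosCone E →+ ExtPosCone E) x s).symm

end PosCone

/-! ### The measure of a positive operator -/

section RepresentingMeasure

variable {X E : Type*} [TopologicalSpace X] [LocallyCompactSpace X] [T2Space X]
  [MeasurableSpace X] [BorelSpace X]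
  [NormedAddCommGroup E] [Lattice E] [IsOrderedAddMonoid E] [HasSolidNorm E]
  [NormedSpace ℝ E] [IsOrderedModule ℝ E]

/-- The continuous functions with values in `[0, 1]` and compact support contained in `V`. -/
def unitFunctions (V : Set X) : Set C_c(X, ℝ) :=
  {f | (∀ x, 0 ≤ f x ∧ f x ≤ 1) ∧ tsupport f ⊆ V}

theorem exists_mem_unitFunctions_eq_one {K V : Set X} (hK : IsCompact K) (hV : IsOpen V)
    (hKV : K ⊆ V) : ∃ f ∈ unitFunctions V, ∀ x ∈ K, f x = 1 := by
  obtain ⟨f, h1, h2, h3, h4⟩ := exists_continuousMap_one_of_isCompact_subset_isOpen hK hV hKV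
  exact ⟨⟨f, h2⟩, ⟨fun x => h4 x, h3⟩, fun x hx => h1 hx⟩

theorem sup_mem_unitFunctions {V : Set X} {f g : C_c(X, ℝ)} (hf : f ∈ unitFunctions V)
    (hg : g ∈ unitFunctions V) : f ⊔ g ∈ unitFunctions V := by
  refine ⟨fun x => ⟨(hf.1 x).1.trans le_sup_left, sup_le (hf.1 x).2 (hg.1 x).2⟩, ?_⟩
  refine (closure_minimal ?_ ((isClosed_tsupport f).union (isClosed_tsupport g))).trans
    (union_subset hf.2 hg.2)
  intro x hx
  by_contra hn
  rw [mem_union, not_or] at hn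
  refine hx ?_
  change f x ⊔ g x = 0
  rw [image_eq_zero_of_notMem_tsupport hn.1, image_eq_zero_of_notMem_tsupport hn.2, sup_idem]

theorem zero_mem_unitFunctions (V : Set X) : (0 : C_c(X, ℝ)) ∈ unitFunctions V :=
  ⟨fun _ => ⟨le_rfl, zero_le_one⟩, by
    have : tsupport (0 : C_c(X, ℝ)) = ∅ := by
      rw [tsupport_eq_empty_iff]; rfl
    rw [this]; exact empty_subset V⟩

/-! ### Scalarization of a positive operator and sets of finite value -/

namespace PositiveLinearMap

variable (T : C_c(X, ℝ) →ₚ[ℝ] E)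

/-- The composition of a positive operator with a positive functional. -/
noncomputable def scalarize (φ : PosDual E) : C_c(X, ℝ) →ₚ[ℝ] ℝ :=
  PositiveLinearMap.mk₀ (φ.1.toLinearMap ∘ₗ T.toLinearMap) fun _ hf => φ.2 _ (T.map_nonneg hf)

theorem scalarize_apply (φ : PosDual E) (f : C_c(X, ℝ)) : T.scalarize φ f = φ.1 (T f) := rfl

/-- The regular Borel measure that represents the composition of `T` with `φ`. -/
noncomputable abbrev scalarMeasure (φ : PosDual E) : Measure X :=
  RealRMK.rieszMeasure (T.scalarize φ)

/-- `x` has the same values under the positive functionals as the scalar measures of `s`. -/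
def HasValue (s : Set X) (x : PosCone E) : Prop :=
  ∀ φ : PosDual E, T.scalarMeasure φ s = ENNReal.ofReal (φ.1 x.1)

/-- `s` is contained in an open set `V` such that the values of `T` at the functions between `0`
and `1` with support in `V` are bounded. -/
def IsFiniteOn (s : Set X) : Prop :=
  ∃ V, IsOpen V ∧ s ⊆ V ∧ BddAbove (T '' unitFunctions V)

variable {T}

theorem IsFiniteOn.mono {s t : Set X} (ht : T.IsFiniteOn t) (h : s ⊆ t) : T.IsFiniteOn s :=
  let ⟨V, hV, htV, hb⟩ := ht
  ⟨V, hV, h.trans htV, hb⟩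

theorem HasValue.le {s t : Set X} {x y : PosCone E} (hx : T.HasValue s x) (hy : T.HasValue t y)
    (h : s ⊆ t) : x ≤ y :=
  PosDual.le_of_forall_le fun φ => by
    have := measure_mono (μ := T.scalarMeasure φ) h
    rwa [hx φ, hy φ, ENNReal.ofReal_le_ofReal_iff (φ.2 _ y.2)] at this

theorem HasValue.unique {s : Set X} {x y : PosCone E} (hx : T.HasValue s x)
    (hy : T.HasValue s y) : x = y :=
  le_antisymm (hx.le hy subset_rfl) (hy.le hx subset_rfl)

/-- Inner regularity of the Riesz measure at `V` gives a compact subset of measure above `r`, and a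
Urysohn function for it suffices. With `ofReal_le_scalarMeasure`, the scalar measure of `V` is the
supremum of the `φ (T f)`. -/
theorem exists_unitFunction_of_lt {V : Set X} (hV : IsOpen V) (φ : PosDual E) {r : ℝ≥0∞}
    (hr : r < T.scalarMeasure φ V) :
    ∃ f ∈ unitFunctions V, r < ENNReal.ofReal (φ.1 (T f)) := by
  obtain ⟨K, hKV, hK, hrK⟩ := hV.exists_lt_isCompact hr
  obtain ⟨f, hf, hf1⟩ := exists_mem_unitFunctions_eq_one hK hV hKV
  exact ⟨f, hf, hrK.trans_le
    (RealRMK.rieszMeasure_le_of_eq_one (T.scalarize φ) (fun x => (hf.1 x).1) hK hf1)⟩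

theorem ofReal_le_scalarMeasure {V : Set X} (φ : PosDual E) {f : C_c(X, ℝ)}
    (hf : f ∈ unitFunctions V) : ENNReal.ofReal (φ.1 (T f)) ≤ T.scalarMeasure φ V :=
  RealRMK.le_rieszMeasure_tsupport_subset (T.scalarize φ) hf.1 hf.2

/-- The element `c` serves all `φ` simultaneously, so the scalar bounds combine to `T f ≤ c`. This
is how finiteness is established for open sets not known to lie in a compact one. -/
theorem isFiniteOn_of_scalarMeasure_le {V : Set X} (hV : IsOpen V) (c : PosCone E)
    (h : ∀ φ : PosDual E, T.scalarMeasure φ V ≤ ENNReal.ofReal (φ.1 c.1)) : T.IsFiniteOn V := by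
  refine ⟨V, hV, subset_rfl, c.1, ?_⟩
  rintro _ ⟨f, hf, rfl⟩
  refine PosDual.le_of_forall_le fun φ => ?_
  rw [← ENNReal.ofReal_le_ofReal_iff (φ.2 _ c.2)]
  exact (ofReal_le_scalarMeasure φ hf).trans (h φ)

theorem IsFiniteOn.bddAbove {V : Set X} (h : T.IsFiniteOn V) :
    BddAbove (T '' unitFunctions V) := by
  obtain ⟨W, _, hVW, hb⟩ := h
  refine hb.mono (image_mono ?_)
  exact fun _ hf => ⟨hf.1, hf.2.trans hVW⟩

/-- A Urysohn function equal to `1` on a compact neighbourhood of `K` dominates all unit functions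
with support in the interior of that neighbourhood, so its image under `T` is a bound. -/
theorem isFiniteOn_of_isCompact {K : Set X} (hK : IsCompact K) : T.IsFiniteOn K := by
  obtain ⟨L, hL, hKL⟩ := exists_compact_superset hK
  obtain ⟨f, hf, hf1⟩ := exists_mem_unitFunctions_eq_one hL isOpen_univ (subset_univ L)
  refine ⟨interior L, isOpen_interior, hKL, T f, ?_⟩
  rintro _ ⟨g, hg, rfl⟩
  refine T.mono fun x => ?_
  by_cases hx : x ∈ L
  · rw [hf1 x hx]; exact (hg.1 x).2
  · rw [image_eq_zero_of_notMem_tsupport fun h => hx (interior_subset (hg.2 h))]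
    exact (hf.1 x).1

/-! ### Values in the cone, countable additivity and regularity -/

variable [CompleteSpace E] (hE : IsOrderContinuousNorm E)
include hE

/-- The value is the supremum of `T f` over the unit functions of `V`. They are directed under `⊔`,
so every `φ` preserves this supremum, and for the Riesz measure of `φ ∘ T` the same supremum
computes the measure of `V`. -/
theorem IsFiniteOn.exists_hasValue_of_isOpen {V : Set X} (hV : IsOpen V) (h : T.IsFiniteOn V) :
    ∃ x, T.HasValue V x := by
  have hne : (T '' unitFunctions V).Nonempty := ⟨_, 0, zero_mem_unitFunctions V, rfl⟩
  have hd : DirectedOn (· ≤ ·) (T '' unitFunctions V) := by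
    rintro _ ⟨f, hf, rfl⟩ _ ⟨g, hg, rfl⟩
    exact ⟨_, ⟨f ⊔ g, sup_mem_unitFunctions hf hg, rfl⟩, T.mono le_sup_left,
      T.mono le_sup_right⟩
  obtain ⟨a, ha⟩ := hE.exists_isLUB hne hd h.bddAbove
  have ha0 : 0 ≤ a := by
    have := ha.1 ⟨0, zero_mem_unitFunctions V, rfl⟩
    rwa [map_zero] at this
  refine ⟨⟨a, ha0⟩, fun φ => le_antisymm (le_of_forall_lt fun r hr => ?_) ?_⟩
  · obtain ⟨f, hf, hrf⟩ := exists_unitFunction_of_lt hV φ hr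
    exact hrf.trans_le (ENNReal.ofReal_le_ofReal (φ.mono (ha.1 ⟨f, hf, rfl⟩)))
  · by_cases htop : T.scalarMeasure φ V = ⊤
    · rw [htop]; exact le_top
    refine ENNReal.ofReal_le_of_le_toReal ((φ.isLUB_image hE hne hd ha).2 ?_)
    rintro _ ⟨_, ⟨f, hf, rfl⟩, rfl⟩
    exact (ENNReal.ofReal_le_iff_le_toReal htop).1 (ofReal_le_scalarMeasure φ hf)

/-- The values at the open sets that contain `s`. -/
def outerValues (T : C_c(X, ℝ) →ₚ[ℝ] E) (s : Set X) : Set E :=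
  {y | ∃ V, IsOpen V ∧ s ⊆ V ∧ T.IsFiniteOn V ∧ ∃ z, T.HasValue V z ∧ z.1 = y}

theorem directedOn_outerValues (s : Set X) :
    DirectedOn (fun x y => y ≤ x) (outerValues T s) := by
  rintro _ ⟨V, hV, hsV, hVf, x, hx, rfl⟩ _ ⟨W, hW, hsW, hWf, y, hy, rfl⟩
  have hf : T.IsFiniteOn (V ∩ W) := hVf.mono inter_subset_left
  obtain ⟨z, hz⟩ := hf.exists_hasValue_of_isOpen hE (hV.inter hW)
  exact ⟨_, ⟨_, hV.inter hW, subset_inter hsV hsW, hf, z, hz, rfl⟩,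
    hz.le hx inter_subset_left, hz.le hy inter_subset_right⟩

theorem IsFiniteOn.nonempty_outerValues {s : Set X} (h : T.IsFiniteOn s) :
    (outerValues T s).Nonempty := by
  obtain ⟨V, hV, hsV, hb⟩ := h
  have hf : T.IsFiniteOn V := ⟨V, hV, subset_rfl, hb⟩
  obtain ⟨z, hz⟩ := hf.exists_hasValue_of_isOpen hE hV
  exact ⟨_, V, hV, hsV, hf, z, hz, rfl⟩

/-- The infimum of the values at open supersets is preserved by every `φ`, as these sets are
directed under intersection; outer regularity of each scalar measure identifies the result. -/
theorem IsFiniteOn.exists_isGLB_outerValues {s : Set X} (h : T.IsFiniteOn s) :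
    ∃ x, T.HasValue s x ∧ IsGLB (outerValues T s) x.1 := by
  have hne := h.nonempty_outerValues hE
  have hd := directedOn_outerValues (T := T) hE s
  have h0 : (0 : E) ∈ lowerBounds (outerValues T s) := by
    rintro _ ⟨V, -, -, -, z, -, rfl⟩; exact z.2
  obtain ⟨a, ha⟩ := hE.exists_isGLB hne hd ⟨0, h0⟩
  refine ⟨⟨a, ha.2 h0⟩, fun φ => le_antisymm ?_ (le_of_forall_gt fun r hr => ?_), ha⟩
  · have ⟨_, V, hV, hsV, _, y, hy, _⟩ := hne
    have htop : T.scalarMeasure φ s ≠ ⊤ :=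
      ne_top_of_le_ne_top (by rw [hy φ]; exact ENNReal.ofReal_ne_top) (measure_mono hsV)
    rw [← ENNReal.ofReal_toReal htop]
    refine ENNReal.ofReal_le_ofReal ((φ.isGLB_image hE hne hd ha).2 ?_)
    rintro _ ⟨_, ⟨V, hV, hsV, -, y, hy, rfl⟩, rfl⟩
    refine ENNReal.toReal_le_of_le_ofReal (φ.2 _ y.2) ?_
    rw [← hy φ]
    exact measure_mono hsV
  -- This `V` depends on `φ` and need not have a value in `E`; cutting it down by one fixed `W` on
  -- which `T` is order bounded repairs that.
  · obtain ⟨V, hsV, hV, hVr⟩ := s.exists_isOpen_lt_of_lt r hr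
    obtain ⟨W, hW, hsW, hb⟩ := h
    have hf : T.IsFiniteOn (V ∩ W) := ⟨W, hW, inter_subset_right, hb⟩
    obtain ⟨z, hz⟩ := hf.exists_hasValue_of_isOpen hE (hV.inter hW)
    refine lt_of_le_of_lt ?_ ((measure_mono (inter_subset_left (t := W))).trans_lt hVr)
    rw [hz φ]
    exact ENNReal.ofReal_le_ofReal
      (φ.mono (ha.1 ⟨_, hV.inter hW, subset_inter hsV hsW, hf, z, hz, rfl⟩))

theorem IsFiniteOn.exists_hasValue {s : Set X} (h : T.IsFiniteOn s) : ∃ x, T.HasValue s x :=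
  let ⟨x, hx, _⟩ := h.exists_isGLB_outerValues hE
  ⟨x, hx⟩

theorem IsFiniteOn.exists_isOpen_norm_sub_lt {s : Set X} (h : T.IsFiniteOn s) {x : PosCone E}
    (hx : T.HasValue s x) {ε : ℝ} (hε : 0 < ε) :
    ∃ V y, IsOpen V ∧ s ⊆ V ∧ T.HasValue V y ∧ ‖y.1 - x.1‖ < ε := by
  obtain ⟨x', hx', hG⟩ := h.exists_isGLB_outerValues hE
  rw [hx'.unique hx] at hG
  obtain ⟨_, ⟨V, hV, hsV, -, z, hz, rfl⟩, hn⟩ := hE.exists_norm_sub_lt_of_isGLB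
    (h.nonempty_outerValues hE) (directedOn_outerValues hE s) hG hε
  exact ⟨V, z, hV, hsV, hz, hn⟩

/-- Order continuity gives open supersets whose values exceed those of the `s n` by less than `(1 /
2) ^ n` in norm. These excesses sum in `E`, so `c` plus their sum bounds every scalar measure of the
union of the open sets. -/
theorem isFiniteOn_iUnion {s : ℕ → Set X} (hs : ∀ n, T.IsFiniteOn (s n)) {x : ℕ → PosCone E}
    (hx : ∀ n, T.HasValue (s n) (x n)) (c : PosCone E)
    (hc : ∀ N, ∑ n ∈ Finset.range N, (x n).1 ≤ c.1) : T.IsFiniteOn (⋃ n, s n) := by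
  choose V y hV hsV hy hyx using fun n =>
    (hs n).exists_isOpen_norm_sub_lt hE (hx n) (ε := (1 / 2) ^ n) (by positivity)
  have hle : ∀ n, 0 ≤ (y n).1 - (x n).1 := fun n => sub_nonneg.2 ((hx n).le (hy n) (hsV n))
  have hsum : Summable fun n => (y n).1 - (x n).1 :=
    Summable.of_norm_bounded summable_geometric_two fun n => (hyx n).le
  have hz : 0 ≤ ∑' n, ((y n).1 - (x n).1) := tsum_nonneg hle
  refine (isFiniteOn_of_scalarMeasure_le (isOpen_iUnion hV)
    ⟨c.1 + ∑' n, ((y n).1 - (x n).1), add_nonneg c.2 hz⟩ fun φ => ?_).mono (iUnion_mono hsV)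
  refine (measure_iUnion_le V).trans (ENNReal.tsum_le_of_sum_range_le fun N => ?_)
  simp only [hy _ φ]
  rw [← ENNReal.ofReal_sum_of_nonneg fun n _ => φ.2 _ (y n).2, ← map_sum]
  refine ENNReal.ofReal_le_ofReal (φ.mono ?_)
  have h1 : ∑ n ∈ Finset.range N, (y n).1 =
      ∑ n ∈ Finset.range N, (x n).1 + ∑ n ∈ Finset.range N, ((y n).1 - (x n).1) := by
    rw [← Finset.sum_add_distrib]; simp
  rw [h1]
  exact add_le_add (hc N) (hsum.sum_le_tsum _ fun n _ => hle n)

open Classical in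
/-- The value of the representing measure at a set. -/
noncomputable def measureFun (T : C_c(X, ℝ) →ₚ[ℝ] E) (hE : IsOrderContinuousNorm E) (s : Set X) :
    ExtPosCone E :=
  if MeasurableSet s then
    if h : T.IsFiniteOn s then ((h.exists_hasValue hE).choose : PosCone E) else ⊤
  else 0

theorem measureFun_eq {s : Set X} (hs : MeasurableSet s) (h : T.IsFiniteOn s) {x : PosCone E}
    (hx : T.HasValue s x) : T.measureFun hE s = x := by
  rw [measureFun, if_pos hs, dif_pos h, (h.exists_hasValue hE).choose_spec.unique hx]

theorem measureFun_eq_top {s : Set X} (hs : MeasurableSet s) (h : ¬T.IsFiniteOn s) :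
    T.measureFun hE s = ⊤ := by
  rw [measureFun, if_pos hs, dif_neg h]

theorem isFiniteOn_of_measureFun_ne_top {s : Set X} (hs : MeasurableSet s)
    (h : T.measureFun hE s ≠ ⊤) : T.IsFiniteOn s := by
  by_contra h'
  exact h (measureFun_eq_top hE hs h')

/-- The measure that represents the positive operator `T`. -/
noncomputable def representingMeasure (T : C_c(X, ℝ) →ₚ[ℝ] E) (hE : IsOrderContinuousNorm E) :
    ExtMeasure X E where
  toFun := T.measureFun hE
  not_measurable' s hs := if_neg hs
  empty' := measureFun_eq hE MeasurableSet.empty (isFiniteOn_of_isCompact isCompact_empty)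
    (x := 0) fun φ => by
      rw [measure_empty, show (0 : PosCone E).1 = 0 from rfl, map_zero, ENNReal.ofReal_zero]
  iUnion' s hs hd := by
    have hU : MeasurableSet (⋃ n, s n) := MeasurableSet.iUnion hs
    have key : ∀ (x : ℕ → PosCone E) (φ : PosDual E), (∀ n, T.HasValue (s n) (x n)) → ∀ N,
        ∑ n ∈ Finset.range N, T.scalarMeasure φ (s n) =
          ENNReal.ofReal (φ.1 (∑ n ∈ Finset.range N, x n).1) := by
      intro x φ hx N
      simp only [hx _ φ]
      rw [← ENNReal.ofReal_sum_of_nonneg fun n _ => φ.2 _ (x n).2, ← map_sum, PosCone.coe_sum_val]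
    by_cases hf : T.IsFiniteOn (⋃ n, s n)
    · have hsf : ∀ n, T.IsFiniteOn (s n) := fun n => hf.mono (subset_iUnion s n)
      choose x hx using fun n => (hsf n).exists_hasValue hE
      obtain ⟨a, ha⟩ := hf.exists_hasValue hE
      simp only [measureFun_eq hE hU hf ha, fun n => measureFun_eq hE (hs n) (hsf n) (hx n),
        PosCone.coe_sum_withTop]
      refine ⟨?_, fun c hc => ?_⟩
      · rintro _ ⟨N, rfl⟩
        refine WithTop.coe_le_coe.2 (PosDual.le_of_forall_le fun φ => ?_)
        rw [← ENNReal.ofReal_le_ofReal_iff (φ.2 _ a.2), ← key x φ hx, ← ha φ,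
          measure_iUnion hd hs]
        exact ENNReal.sum_le_tsum _
      · induction c using WithTop.recTopCoe with
        | top => exact le_top
        | coe c =>
          refine WithTop.coe_le_coe.2 (PosDual.le_of_forall_le fun φ => ?_)
          rw [← ENNReal.ofReal_le_ofReal_iff (φ.2 _ c.2), ← ha φ, measure_iUnion hd hs]
          refine ENNReal.tsum_le_of_sum_range_le fun N => ?_
          rw [key x φ hx]
          exact ENNReal.ofReal_le_ofReal (φ.mono (PosCone.val_le_val_of_coe_le_coe (hc ⟨N, rfl⟩)))
    -- The supremum is `∞`, since a finite upper bound `c` of the partial sums would make the union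
    -- a set of finite value.
    · rw [measureFun_eq_top hE hU hf]
      refine ⟨fun _ _ => le_top, fun c hc => ?_⟩
      induction c using WithTop.recTopCoe with
      | top => exact le_top
      | coe c =>
        refine absurd ?_ hf
        have hsf : ∀ n, T.IsFiniteOn (s n) := fun n => by
          refine isFiniteOn_of_measureFun_ne_top hE (hs n) fun htop => ?_
          -- The partial sum of length `n + 1` is the first to contain the term of index `n`.
          have := hc ⟨n + 1, rfl⟩
          simp only [Finset.sum_range_succ, htop, WithTop.add_top] at this
          simp at this
        choose x hx using fun n => (hsf n).exists_hasValue hE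
        refine isFiniteOn_iUnion hE hsf hx c fun N => ?_
        have := hc ⟨N, rfl⟩
        simp only [fun n => measureFun_eq hE (hs n) (hsf n) (hx n), PosCone.coe_sum_withTop] at this
        rw [← PosCone.coe_sum_val]
        exact PosCone.val_le_val_of_coe_le_coe this

theorem representingMeasure_eq {s : Set X} (hs : MeasurableSet s) (h : T.IsFiniteOn s)
    {x : PosCone E} (hx : T.HasValue s x) : T.representingMeasure hE s = x :=
  measureFun_eq hE hs h hx

/-- Outer regularity is built into the values as infima over open sets. Inner regularity comes from
that of the scalar measures: a finite upper bound of the values at compact subsets bounds every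
scalar measure of `V`, and hence forces `V` to have finite value. -/
theorem isRegularBorel_representingMeasure (T : C_c(X, ℝ) →ₚ[ℝ] E) :
    (T.representingMeasure hE).IsRegularBorel where
  isBorel K hK := by
    have hf : T.IsFiniteOn K := isFiniteOn_of_isCompact hK
    obtain ⟨x, hx⟩ := hf.exists_hasValue hE
    rw [representingMeasure_eq hE hK.measurableSet hf hx]
    exact WithTop.coe_ne_top
  innerRegular V hV := by
    refine ⟨?_, fun c hc => ?_⟩
    · rintro _ ⟨K, rfl⟩
      exact ExtMeasure.mono _ K.2.1.measurableSet hV.measurableSet K.2.2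
    · induction c using WithTop.recTopCoe with
      | top => exact le_top
      | coe c =>
        have hle : ∀ φ : PosDual E, T.scalarMeasure φ V ≤ ENNReal.ofReal (φ.1 c.1) := by
          refine fun φ => le_of_forall_lt fun r hr => ?_
          obtain ⟨K, hKV, hK, hrK⟩ := hV.exists_lt_isCompact hr
          refine hrK.trans_le ?_
          have hf : T.IsFiniteOn K := isFiniteOn_of_isCompact hK
          obtain ⟨x, hx⟩ := hf.exists_hasValue hE
          have := hc ⟨⟨K, hK, hKV⟩, rfl⟩
          simp only [representingMeasure_eq hE hK.measurableSet hf hx] at this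
          rw [hx φ]
          exact ENNReal.ofReal_le_ofReal (φ.mono (PosCone.val_le_val_of_coe_le_coe this))
        have hf := isFiniteOn_of_scalarMeasure_le hV c hle
        obtain ⟨x, hx⟩ := hf.exists_hasValue hE
        rw [representingMeasure_eq hE hV.measurableSet hf hx]
        refine WithTop.coe_le_coe.2 (PosDual.le_of_forall_le fun φ => ?_)
        rw [← ENNReal.ofReal_le_ofReal_iff (φ.2 _ c.2), ← hx φ]
        exact hle φ
  outerRegular s hs := by
    refine ⟨?_, fun c hc => ?_⟩
    · rintro _ ⟨V, rfl⟩
      exact ExtMeasure.mono _ hs V.2.1.measurableSet V.2.2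
    · by_cases hf : T.IsFiniteOn s
      · obtain ⟨x, hx, hG⟩ := hf.exists_isGLB_outerValues hE
        rw [representingMeasure_eq hE hs hf hx]
        -- The lower bound `c` is not yet known to be finite; that follows by comparison with a
        -- single open superset of finite value.
        have hc' : ∀ y ∈ outerValues T s, ∀ c' : PosCone E, c = c' → c'.1 ≤ y := by
          rintro _ ⟨V, hV, hsV, hVf, y, hy, rfl⟩ c' rfl
          have := hc ⟨⟨V, hV, hsV⟩, rfl⟩
          simp only [representingMeasure_eq hE hV.measurableSet hVf hy] at this
          exact PosCone.val_le_val_of_coe_le_coe this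
        obtain ⟨_, V, hV, hsV, hVf, y, hy, -⟩ := hf.nonempty_outerValues hE
        have hcV := hc ⟨⟨V, hV, hsV⟩, rfl⟩
        simp only [representingMeasure_eq hE hV.measurableSet hVf hy] at hcV
        lift c to PosCone E using ne_top_of_le_ne_top WithTop.coe_ne_top hcV
        exact WithTop.coe_le_coe.2 (hG.2 fun y hy => hc' y hy c rfl)
      · rw [show T.representingMeasure hE s = ⊤ from measureFun_eq_top hE hs hf]
        exact le_top

end PositiveLinearMap

end RepresentingMeasure

/-! ### The order integral of bounded functions with support in a set of finite measure -/

namespace ExtMeasure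

section ScalarIntegral

variable {X E : Type*} [MeasurableSpace X]
  [NormedAddCommGroup E] [Lattice E] [IsOrderedAddMonoid E] [HasSolidNorm E]
  [NormedSpace ℝ E] [IsOrderedModule ℝ E]

/-- The value of `μ` at `s` as an element of `E₊`, which is `0` if `μ s = ∞`. -/
def val (μ : ExtMeasure X E) (s : Set X) : PosCone E := (μ s).untopD 0

theorem coe_val {μ : ExtMeasure X E} {s : Set X} (h : μ s ≠ ⊤) : (μ.val s : ExtPosCone E) = μ s := by
  rw [val]
  lift μ s to PosCone E using h with x
  rfl

theorem val_eq {μ : ExtMeasure X E} {s : Set X} {x : PosCone E} (h : μ s = x) : μ.val s = x := by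
  rw [val, h]; rfl

theorem val_empty (μ : ExtMeasure X E) : μ.val ∅ = 0 := val_eq μ.empty'

theorem ne_top_of_subset {μ : ExtMeasure X E} {s t : Set X} (hs : MeasurableSet s)
    (ht : MeasurableSet t) (h : s ⊆ t) (hμ : μ t ≠ ⊤) : μ s ≠ ⊤ :=
  ne_top_of_le_ne_top hμ (μ.mono hs ht h)

/-- The partial sums increase to the value of the union, and `φ` preserves directed suprema. This
turns order countable additivity into countable additivity of scalar measures. -/
theorem hasSum_apply_val (hE : IsOrderContinuousNorm E) (μ : ExtMeasure X E) (φ : PosDual E)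
    {s : ℕ → Set X} (hs : ∀ n, MeasurableSet (s n)) (hd : Pairwise (Function.onFun Disjoint s))
    (hU : μ (⋃ n, s n) ≠ ⊤) :
    HasSum (fun n => φ.1 (μ.val (s n)).1) (φ.1 (μ.val (⋃ n, s n)).1) := by
  have hn : ∀ n, μ (s n) = μ.val (s n) := fun n =>
    (coe_val (ne_top_of_subset (hs n) (MeasurableSet.iUnion hs) (subset_iUnion s n) hU)).symm
  have hL := μ.iUnion' s hs hd
  change IsLUB (range fun N : ℕ => ∑ n ∈ Finset.range N, μ (s n)) (μ (⋃ n, s n)) at hL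
  simp only [hn, PosCone.coe_sum_withTop, ← coe_val hU] at hL
  have hmono : Monotone fun N => ∑ n ∈ Finset.range N, (μ.val (s n)).1 :=
    monotone_nat_of_le_succ fun N => by
      rw [Finset.sum_range_succ]; exact le_add_of_nonneg_right (μ.val (s N)).2
  have hL' : IsLUB (range fun N => ∑ n ∈ Finset.range N, (μ.val (s n)).1)
      (μ.val (⋃ n, s n)).1 := by
    refine ⟨?_, fun c hc => ?_⟩
    · rintro _ ⟨N, rfl⟩
      have := PosCone.val_le_val_of_coe_le_coe (hL.1 ⟨N, rfl⟩)
      rwa [PosCone.coe_sum_val] at this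
    -- The empty partial sum shows that an upper bound in `E` lies in the positive cone.
    · have hc0 : 0 ≤ c := hc ⟨0, rfl⟩
      refine PosCone.val_le_val_of_coe_le_coe (y := ⟨c, hc0⟩) (hL.2 ?_)
      rintro _ ⟨N, rfl⟩
      refine WithTop.coe_le_coe.2 ?_
      change (∑ n ∈ Finset.range N, μ.val (s n)).1 ≤ c
      rw [PosCone.coe_sum_val]
      exact hc ⟨N, rfl⟩
  have := φ.isLUB_image hE (range_nonempty _) (directedOn_range.2 hmono.directed_le) hL'
  rw [← range_comp] at this
  rw [hasSum_iff_tendsto_nat_of_nonneg fun n => φ.2 _ (μ.val (s n)).2]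
  have ht := tendsto_atTop_isLUB (fun a b h => φ.mono (hmono h)) this
  refine ht.congr fun N => ?_
  exact map_sum φ.1 _ _

/-- The finite scalar measure `s ↦ φ (μ (s ∩ K))`. -/
noncomputable def scalarMeasureOn (hE : IsOrderContinuousNorm E) (μ : ExtMeasure X E) {K : Set X}
    (hK : MeasurableSet K) (hμ : μ K ≠ ⊤) (φ : PosDual E) : Measure X :=
  Measure.ofMeasurable (fun s _ => ENNReal.ofReal (φ.1 (μ.val (s ∩ K)).1))
    (by
      rw [empty_inter, val_empty, show (0 : PosCone E).1 = 0 from rfl, map_zero,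
        ENNReal.ofReal_zero])
    (fun s hs hd => by
      have hd' : Pairwise (Function.onFun Disjoint fun n => s n ∩ K) := fun i j hij =>
        (hd hij).mono inter_subset_left inter_subset_left
      have hm : ∀ n, MeasurableSet (s n ∩ K) := fun n => (hs n).inter hK
      rw [iUnion_inter]
      have hsum := hasSum_apply_val hE μ φ hm hd' (ne_top_of_subset (MeasurableSet.iUnion hm) hK
        (iUnion_subset fun n => inter_subset_right) hμ)
      rw [← hsum.tsum_eq]
      exact ENNReal.ofReal_tsum_of_nonneg (fun n => φ.2 _ (PosCone.val_nonneg _)) hsum.summable)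

variable {hE : IsOrderContinuousNorm E} {μ : ExtMeasure X E} {K : Set X}
  {hK : MeasurableSet K} {hμ : μ K ≠ ⊤}

theorem scalarMeasureOn_apply (φ : PosDual E) {s : Set X} (hs : MeasurableSet s) :
    μ.scalarMeasureOn hE hK hμ φ s = ENNReal.ofReal (φ.1 (μ.val (s ∩ K)).1) :=
  Measure.ofMeasurable_apply s hs

instance isFiniteMeasure_scalarMeasureOn (φ : PosDual E) :
    IsFiniteMeasure (μ.scalarMeasureOn hE hK hμ φ) :=
  ⟨by rw [scalarMeasureOn_apply φ MeasurableSet.univ]; exact ENNReal.ofReal_lt_top⟩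

/-- The fibres over non-zero values lie in `K` and have finite measure. The fibre over `0` may have
measure `∞`, but contributes nothing as `0 • ∞ = 0`. -/
theorem exists_elemIntegral_eq (hE : IsOrderContinuousNorm E) (hK : MeasurableSet K)
    (hμ : μ K ≠ ⊤) (ψ : SimpleFunc X ℝ≥0) (hψ : ∀ x ∉ K, ψ x = 0) :
    ∃ p : PosCone E, μ.elemIntegral ψ = p ∧
      ∀ φ, ENNReal.ofReal (φ.1 p.1) = ∫⁻ x, ψ x ∂μ.scalarMeasureOn hE hK hμ φ := by
  refine ⟨∑ r ∈ ψ.range, r • μ.val (ψ ⁻¹' {r} ∩ K), ?_, fun φ => ?_⟩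
  · rw [elemIntegral, ← PosCone.coe_sum_withTop]
    refine Finset.sum_congr rfl fun r _ => ?_
    by_cases hr : r = 0
    · rw [hr, zero_smul, zero_smul]; rfl
    · have hsub : ψ ⁻¹' {r} ⊆ K := fun x hx => by
        by_contra hxK
        exact hr (hx.symm.trans (hψ x hxK))
      rw [← ExtPosCone.smul_coe, inter_eq_left.2 hsub,
        coe_val (ne_top_of_subset (ψ.measurableSet_fiber r) hK hsub hμ)]
  · have h1 := SimpleFunc.map_lintegral (μ := μ.scalarMeasureOn hE hK hμ φ)
      (fun r : ℝ≥0 => (r : ℝ≥0∞)) ψ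
    rw [← SimpleFunc.lintegral_eq_lintegral] at h1
    simp only [SimpleFunc.map_apply] at h1
    rw [h1, PosCone.coe_sum_val, map_sum,
      ENNReal.ofReal_sum_of_nonneg fun r _ => φ.2 _ (PosCone.val_nonneg _)]
    refine Finset.sum_congr rfl fun r _ => ?_
    rw [scalarMeasureOn_apply φ (ψ.measurableSet_fiber r),
      show (r • μ.val (ψ ⁻¹' {r} ∩ K)).1 = (r : ℝ) • (μ.val (ψ ⁻¹' {r} ∩ K)).1 from rfl,
      map_smul, smul_eq_mul, ENNReal.ofReal_mul r.coe_nonneg, ENNReal.ofReal_coe_nnreal]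

/-- The existence of one approximating sequence prevents `HasPosIntegral` from holding vacuously,
and so makes order integrals unique. -/
theorem exists_monotone_simpleFunc {f : X → ℝ≥0∞} (hf : Measurable f) :
    ∃ ψ : ℕ → SimpleFunc X ℝ≥0, Monotone ψ ∧ ∀ x, ⨆ n, (ψ n x : ℝ≥0∞) = f x := by
  have hcoe : ∀ n x, (((SimpleFunc.eapprox f n).map ENNReal.toNNReal x : ℝ≥0) : ℝ≥0∞) =
      SimpleFunc.eapprox f n x := fun n x =>
    ENNReal.coe_toNNReal (SimpleFunc.eapprox_lt_top f n x).ne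
  refine ⟨fun n => (SimpleFunc.eapprox f n).map ENNReal.toNNReal, fun m n hmn x => ?_,
    fun x => ?_⟩
  · rw [← ENNReal.coe_le_coe, hcoe, hcoe]
    exact SimpleFunc.monotone_eapprox f hmn x
  · simp only [hcoe]
    exact SimpleFunc.iSup_eapprox_apply hf x

theorem HasPosIntegral.unique {f : X → ℝ≥0∞} {a b : ExtPosCone E} (ha : μ.HasPosIntegral f a)
    (hb : μ.HasPosIntegral f b) : a = b := by
  obtain ⟨ψ, hψ, hψf⟩ := exists_monotone_simpleFunc ha.1
  exact (ha.2 ψ hψ hψf).unique (hb.2 ψ hψ hψf)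

theorem HasIntegral.unique {f : X → ℝ} {a b : E} (ha : μ.HasIntegral f a)
    (hb : μ.HasIntegral f b) : a = b := by
  obtain ⟨-, p, q, hp, hq, rfl⟩ := ha
  obtain ⟨-, p', q', hp', hq', rfl⟩ := hb
  rw [WithTop.coe_injective (hp.unique hp'), WithTop.coe_injective (hq.unique hq')]

/-- The integrals of an approximating sequence increase and are bounded by `C • μ K`, so they have a
supremum `a` in `E`. By monotone convergence `φ a` is the scalar integral of `f`, which does not
involve the sequence; as the `φ` determine the order, any other sequence has the supremum `a` too.
-/
theorem exists_hasPosIntegral [CompleteSpace E] (hE : IsOrderContinuousNorm E)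
    (hK : MeasurableSet K) (hμ : μ K ≠ ⊤) {f : X → ℝ≥0∞} (hf : Measurable f)
    (hfK : ∀ x ∉ K, f x = 0) {C : ℝ≥0} (hC : ∀ x, f x ≤ C) :
    ∃ a : PosCone E, μ.HasPosIntegral f a ∧
      ∀ φ, ENNReal.ofReal (φ.1 a.1) = ∫⁻ x, f x ∂μ.scalarMeasureOn hE hK hμ φ := by
  have key : ∀ ψ : ℕ → SimpleFunc X ℝ≥0, Monotone ψ → (∀ x, ⨆ n, (ψ n x : ℝ≥0∞) = f x) →
      ∃ p : ℕ → PosCone E, (∀ n, μ.elemIntegral (ψ n) = p n) ∧ Monotone (fun n => (p n).1) ∧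
        ∀ φ, ⨆ n, ENNReal.ofReal (φ.1 (p n).1) =
          ∫⁻ x, f x ∂μ.scalarMeasureOn hE hK hμ φ := by
    intro ψ hψ hψf
    have hψK : ∀ n, ∀ x ∉ K, ψ n x = 0 := fun n x hx => by
      have := le_iSup (fun n => (ψ n x : ℝ≥0∞)) n
      rw [hψf x, hfK x hx] at this
      simpa using this
    choose p hp hpφ using fun n => exists_elemIntegral_eq hE hK hμ (ψ n) (hψK n)
    refine ⟨p, hp, fun m n hmn => PosDual.le_of_forall_le fun φ => ?_, fun φ => ?_⟩
    · rw [← ENNReal.ofReal_le_ofReal_iff (φ.2 _ (p n).2), hpφ, hpφ]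
      exact lintegral_mono fun x => ENNReal.coe_le_coe.2 (hψ hmn x)
    · simp only [hpφ, ← hψf]
      exact (lintegral_iSup (fun n => (ψ n).measurable.coe_nnreal_ennreal)
        fun m n hmn x => ENNReal.coe_le_coe.2 (hψ hmn x)).symm
  have hbound : ∀ φ, ∫⁻ x, f x ∂μ.scalarMeasureOn hE hK hμ φ ≤
      ENNReal.ofReal (φ.1 (C • μ.val K).1) := by
    intro φ
    refine (lintegral_mono hC).trans ?_
    rw [lintegral_const, scalarMeasureOn_apply φ MeasurableSet.univ, univ_inter,
      show (C • μ.val K).1 = (C : ℝ) • (μ.val K).1 from rfl, map_smul, smul_eq_mul,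
      ENNReal.ofReal_mul C.coe_nonneg, ENNReal.ofReal_coe_nnreal]
  obtain ⟨ψ, hψ, hψf⟩ := exists_monotone_simpleFunc hf
  obtain ⟨p, -, hpm, hpφ⟩ := key ψ hψ hψf
  have hd : DirectedOn (· ≤ ·) (range fun n => (p n).1) := directedOn_range.2 hpm.directed_le
  obtain ⟨a, ha⟩ := hE.exists_isLUB (range_nonempty fun n => (p n).1) hd
    ⟨(C • μ.val K).1, by
      rintro _ ⟨n, rfl⟩
      refine PosDual.le_of_forall_le fun φ => ?_
      rw [← ENNReal.ofReal_le_ofReal_iff (φ.2 _ (PosCone.val_nonneg _))]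
      refine le_trans ?_ (hbound φ)
      rw [← hpφ φ]
      exact le_iSup (fun n => ENNReal.ofReal (φ.1 (p n).1)) n⟩
  have ha0 : 0 ≤ a := (p 0).2.trans (ha.1 ⟨0, rfl⟩)
  have haφ : ∀ φ : PosDual E, ENNReal.ofReal (φ.1 a) =
      ∫⁻ x, f x ∂μ.scalarMeasureOn hE hK hμ φ := by
    intro φ
    have hfin : ∫⁻ x, f x ∂μ.scalarMeasureOn hE hK hμ φ ≠ ⊤ :=
      ne_top_of_le_ne_top ENNReal.ofReal_ne_top (hbound φ)
    refine le_antisymm (ENNReal.ofReal_le_of_le_toReal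
      ((φ.isLUB_image hE (range_nonempty _) hd ha).2 ?_)) ?_
    · rintro _ ⟨_, ⟨n, rfl⟩, rfl⟩
      rw [← ENNReal.ofReal_le_iff_le_toReal hfin, ← hpφ φ]
      exact le_iSup (fun n => ENNReal.ofReal (φ.1 (p n).1)) n
    · rw [← hpφ φ]
      exact iSup_le fun n => ENNReal.ofReal_le_ofReal (φ.mono (ha.1 ⟨n, rfl⟩))
  refine ⟨⟨a, ha0⟩, ⟨hf, fun χ hχ hχf => ?_⟩, haφ⟩
  obtain ⟨q, hq, -, hqφ⟩ := key χ hχ hχf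
  simp only [hq]
  refine ⟨?_, fun c hc => ?_⟩
  · rintro _ ⟨n, rfl⟩
    refine WithTop.coe_le_coe.2 (PosDual.le_of_forall_le fun φ => ?_)
    rw [← ENNReal.ofReal_le_ofReal_iff (φ.2 _ ha0), haφ φ, ← hqφ φ]
    exact le_iSup (fun n => ENNReal.ofReal (φ.1 (q n).1)) n
  · induction c using WithTop.recTopCoe with
    | top => exact le_top
    | coe c =>
      refine WithTop.coe_le_coe.2 (PosDual.le_of_forall_le fun φ => ?_)
      rw [← ENNReal.ofReal_le_ofReal_iff (φ.2 _ c.2), haφ φ, ← hqφ φ]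
      exact iSup_le fun n => ENNReal.ofReal_le_ofReal
        (φ.mono (PosCone.val_le_val_of_coe_le_coe (hc ⟨n, rfl⟩)))

theorem exists_hasIntegral [CompleteSpace E] (hE : IsOrderContinuousNorm E)
    (hK : MeasurableSet K) (hμ : μ K ≠ ⊤) {f : X → ℝ} (hf : Measurable f)
    (hfK : ∀ x ∉ K, f x = 0) {C : ℝ} (hC : ∀ x, |f x| ≤ C) :
    ∃ e : E, μ.HasIntegral f e ∧
      ∀ φ, φ.1 e = ∫ x, f x ∂μ.scalarMeasureOn hE hK hμ φ := by
  obtain ⟨a, ha, haφ⟩ := exists_hasPosIntegral hE hK hμ hf.ennreal_ofReal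
    (fun x hx => by rw [hfK x hx, ENNReal.ofReal_zero]) (C := C.toNNReal)
    fun x => ENNReal.ofReal_le_ofReal ((le_abs_self _).trans (hC x))
  obtain ⟨b, hb, hbφ⟩ := exists_hasPosIntegral hE hK hμ hf.neg.ennreal_ofReal
    (fun x hx => by rw [Pi.neg_apply, hfK x hx, neg_zero, ENNReal.ofReal_zero]) (C := C.toNNReal)
    fun x => ENNReal.ofReal_le_ofReal ((neg_le_abs _).trans (hC x))
  refine ⟨a.1 - b.1, ⟨hf, a, b, ha, hb, rfl⟩, fun φ => ?_⟩
  have hi : Integrable f (μ.scalarMeasureOn hE hK hμ φ) :=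
    Integrable.of_bound hf.aestronglyMeasurable C (ae_of_all _ hC)
  rw [integral_eq_lintegral_pos_part_sub_lintegral_neg_part hi, ← haφ φ, map_sub]
  simp only [Pi.neg_apply] at hbφ
  rw [← hbφ φ, ENNReal.toReal_ofReal (φ.2 _ a.2), ENNReal.toReal_ofReal (φ.2 _ b.2)]

end ScalarIntegral

end ExtMeasure

/-! ### The integral operator of a regular Borel measure -/

section IntegralOperator

variable {X E : Type*} [TopologicalSpace X] [LocallyCompactSpace X] [T2Space X]
  [MeasurableSpace X] [BorelSpace X]
  [NormedAddCommGroup E] [Lattice E] [IsOrderedAddMonoid E] [HasSolidNorm E]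
  [NormedSpace ℝ E] [IsOrderedModule ℝ E]

namespace ExtMeasure

variable [CompleteSpace E] (hE : IsOrderContinuousNorm E)

theorem IsBorel.exists_hasIntegral {μ : ExtMeasure X E} (hμ : μ.IsBorel) {K : Set X}
    (hK : IsCompact K) {f : C_c(X, ℝ)} (hf : tsupport f ⊆ K) :
    ∃ e : E, μ.HasIntegral f e ∧
      ∀ φ, φ.1 e = ∫ x, f x ∂μ.scalarMeasureOn hE hK.measurableSet (hμ K hK) φ := by
  obtain ⟨C, hC⟩ := f.hasCompactSupport.exists_bound_of_continuous f.continuous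
  exact ExtMeasure.exists_hasIntegral hE hK.measurableSet (hμ K hK) f.continuous.measurable
    (fun x hx => image_eq_zero_of_notMem_tsupport fun h => hx (hf h)) hC

/-- The order integral of a continuous function with compact support. -/
noncomputable def IsBorel.integral {μ : ExtMeasure X E} (hμ : μ.IsBorel) (f : C_c(X, ℝ)) : E :=
  (hμ.exists_hasIntegral hE f.hasCompactSupport (subset_refl (tsupport f))).choose

theorem IsBorel.hasIntegral {μ : ExtMeasure X E} (hμ : μ.IsBorel) (f : C_c(X, ℝ)) :
    μ.HasIntegral f (hμ.integral hE f) :=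
  (hμ.exists_hasIntegral hE f.hasCompactSupport (subset_refl (tsupport f))).choose_spec.1

/-- By uniqueness of the order integral, any compact `K` containing the support may be used. Hence
functions with different supports can be compared under one finite scalar measure. -/
theorem IsBorel.apply_integral {μ : ExtMeasure X E} (hμ : μ.IsBorel) {K : Set X}
    (hK : IsCompact K) {f : C_c(X, ℝ)} (hf : tsupport f ⊆ K) (φ : PosDual E) :
    φ.1 (hμ.integral hE f) =
      ∫ x, f x ∂μ.scalarMeasureOn hE hK.measurableSet (hμ K hK) φ := by
  obtain ⟨e, he, h⟩ := hμ.exists_hasIntegral hE hK hf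
  rw [(hμ.hasIntegral hE f).unique he, h φ]

variable {hE} in
theorem integrable_scalarMeasureOn {μ : ExtMeasure X E} {K : Set X} {hK : MeasurableSet K}
    {hμ : μ K ≠ ⊤} {φ : PosDual E} (f : C_c(X, ℝ)) :
    Integrable f (μ.scalarMeasureOn hE hK hμ φ) := by
  obtain ⟨C, hC⟩ := f.hasCompactSupport.exists_bound_of_continuous f.continuous
  exact Integrable.of_bound f.continuous.measurable.aestronglyMeasurable C (ae_of_all _ hC)

/-- The operator that maps `f` to its order integral. -/
noncomputable def IsBorel.integralOperator {μ : ExtMeasure X E} (hμ : μ.IsBorel) :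
    C_c(X, ℝ) →ₗ[ℝ] E where
  toFun := hμ.integral hE
  map_add' f g := PosDual.eq_of_forall_eq fun φ => by
    have hfg : tsupport (f + g : C_c(X, ℝ)) ⊆ tsupport f ∪ tsupport g :=
      tsupport_add f g
    have hK := IsCompact.union f.hasCompactSupport g.hasCompactSupport
    rw [map_add, hμ.apply_integral hE hK hfg, hμ.apply_integral hE hK subset_union_left,
      hμ.apply_integral hE hK subset_union_right,
      ← integral_add (integrable_scalarMeasureOn f) (integrable_scalarMeasureOn g)]
    rfl
  map_smul' r f := PosDual.eq_of_forall_eq fun φ => by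
    have hf : tsupport (r • f : C_c(X, ℝ)) ⊆ tsupport f :=
      closure_mono (Function.support_const_smul_subset r f)
    rw [RingHom.id_apply, map_smul, hμ.apply_integral hE f.hasCompactSupport hf,
      hμ.apply_integral hE f.hasCompactSupport subset_rfl, ← integral_smul]
    rfl

theorem IsBorel.integral_nonneg {μ : ExtMeasure X E} (hμ : μ.IsBorel) {f : C_c(X, ℝ)}
    (hf : 0 ≤ f) : 0 ≤ hμ.integral hE f :=
  PosDual.le_of_forall_le fun φ => by
    rw [map_zero, hμ.apply_integral hE f.hasCompactSupport subset_rfl]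
    exact MeasureTheory.integral_nonneg hf

theorem IsBorel.integral_mono_measure {μ ν : ExtMeasure X E} (hμ : μ.IsBorel) (hν : ν.IsBorel)
    (h : μ ≤ ν) {f : C_c(X, ℝ)} (hf : 0 ≤ f) : hμ.integral hE f ≤ hν.integral hE f :=
  PosDual.le_of_forall_le fun φ => by
    have hK : IsCompact (tsupport f) := f.hasCompactSupport
    rw [hμ.apply_integral hE hK subset_rfl, hν.apply_integral hE hK subset_rfl]
    refine MeasureTheory.integral_mono_measure (Measure.le_iff.2 fun s hs => ?_)
      (ae_of_all _ hf) (integrable_scalarMeasureOn f)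
    have hm := hs.inter hK.measurableSet
    rw [scalarMeasureOn_apply φ hs, scalarMeasureOn_apply φ hs]
    have := h _ hm
    rw [← coe_val (ne_top_of_subset hm hK.measurableSet inter_subset_right (hμ _ hK)),
      ← coe_val (ne_top_of_subset hm hK.measurableSet inter_subset_right (hν _ hK))] at this
    exact ENNReal.ofReal_le_ofReal (φ.mono (PosCone.val_le_val_of_coe_le_coe this))

theorem IsBorel.integral_add_measure {μ ν : ExtMeasure X E} (hμ : μ.IsBorel) (hν : ν.IsBorel)
    (h : (μ + ν).IsBorel) (f : C_c(X, ℝ)) :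
    h.integral hE f = hμ.integral hE f + hν.integral hE f :=
  PosDual.eq_of_forall_eq fun φ => by
    have hK : IsCompact (tsupport f) := f.hasCompactSupport
    rw [map_add, h.apply_integral hE hK subset_rfl, hμ.apply_integral hE hK subset_rfl,
      hν.apply_integral hE hK subset_rfl, ← MeasureTheory.integral_add_measure
        (integrable_scalarMeasureOn f) (integrable_scalarMeasureOn f)]
    congr 1
    ext s hs
    have hm := hs.inter hK.measurableSet
    have hval : (μ + ν).val (s ∩ tsupport f) =
        μ.val (s ∩ tsupport f) + ν.val (s ∩ tsupport f) := by
      refine val_eq ?_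
      rw [WithTop.coe_add,
        coe_val (ne_top_of_subset hm hK.measurableSet inter_subset_right (hμ _ hK)),
        coe_val (ne_top_of_subset hm hK.measurableSet inter_subset_right (hν _ hK))]
      rfl
    rw [Measure.add_apply, scalarMeasureOn_apply φ hs, scalarMeasureOn_apply φ hs,
      scalarMeasureOn_apply φ hs, hval, ← ENNReal.ofReal_add (φ.2 _ (PosCone.val_nonneg _))
        (φ.2 _ (PosCone.val_nonneg _)), ← map_add]
    rfl

theorem IsBorel.integral_smul_measure {μ : ExtMeasure X E} (hμ : μ.IsBorel) (r : ℝ≥0)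
    (h : (r • μ).IsBorel) (f : C_c(X, ℝ)) :
    h.integral hE f = (r : ℝ) • hμ.integral hE f :=
  PosDual.eq_of_forall_eq fun φ => by
    have hK : IsCompact (tsupport f) := f.hasCompactSupport
    rw [map_smul, h.apply_integral hE hK subset_rfl, hμ.apply_integral hE hK subset_rfl]
    refine Eq.trans ?_ (integral_smul_nnreal_measure f r)
    congr 1
    ext s hs
    have hm := hs.inter hK.measurableSet
    have hval : (r • μ).val (s ∩ tsupport f) = r • μ.val (s ∩ tsupport f) := by
      refine val_eq ?_
      rw [← ExtPosCone.smul_coe,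
        coe_val (ne_top_of_subset hm hK.measurableSet inter_subset_right (hμ _ hK))]
      rfl
    rw [Measure.smul_apply, scalarMeasureOn_apply φ hs, scalarMeasureOn_apply φ hs, hval,
      show (r • μ.val (s ∩ tsupport f)).1 = (r : ℝ) • (μ.val (s ∩ tsupport f)).1 from rfl,
      map_smul, smul_eq_mul, ENNReal.ofReal_mul r.coe_nonneg, ENNReal.ofReal_coe_nnreal]
    rfl

/-- Integrate the indicator of `K`, which lies below `f`, against each scalar measure on the support
of `f`. -/
theorem IsBorel.le_integral {μ : ExtMeasure X E} (hμ : μ.IsBorel) {K : Set X} (hK : IsCompact K)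
    {f : C_c(X, ℝ)} (hf : 0 ≤ f) (hfK : ∀ x ∈ K, f x = 1) : (μ.val K).1 ≤ hμ.integral hE f :=
  PosDual.le_of_forall_le fun φ => by
    have hKf : K ⊆ tsupport f := fun x hx => subset_closure (by
      rw [Function.mem_support, hfK x hx]; exact one_ne_zero)
    have hL : IsCompact (tsupport f) := f.hasCompactSupport
    have hreal : (μ.scalarMeasureOn hE hL.measurableSet (hμ _ hL) φ).real K =
        φ.1 (μ.val K).1 := by
      rw [Measure.real, scalarMeasureOn_apply φ hK.measurableSet, inter_eq_left.2 hKf,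
        ENNReal.toReal_ofReal (φ.2 _ (PosCone.val_nonneg _))]
    rw [hμ.apply_integral hE hL subset_rfl, ← hreal, ← integral_indicator_one hK.measurableSet]
    refine integral_mono ((integrable_const 1).indicator hK.measurableSet)
      (integrable_scalarMeasureOn f) fun x => ?_
    by_cases hx : x ∈ K
    · rw [indicator_of_mem hx, hfK x hx]; rfl
    · rw [indicator_of_notMem hx]; exact hf x

/-- The function is dominated by the indicator of its support, a compact subset of `W`. -/
theorem IsBorel.integral_le {μ : ExtMeasure X E} (hμ : μ.IsBorel) {W : Set X} (hW : IsOpen W)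
    (hμW : μ W ≠ ⊤) {f : C_c(X, ℝ)} (hf : f ∈ unitFunctions W) :
    hμ.integral hE f ≤ (μ.val W).1 :=
  PosDual.le_of_forall_le fun φ => by
    have hL : IsCompact (tsupport f) := f.hasCompactSupport
    have hreal : (μ.scalarMeasureOn hE hL.measurableSet (hμ _ hL) φ).real (tsupport f) =
        φ.1 (μ.val (tsupport f)).1 := by
      rw [Measure.real, scalarMeasureOn_apply φ hL.measurableSet, inter_self,
        ENNReal.toReal_ofReal (φ.2 _ (PosCone.val_nonneg _))]
    have hle : (μ.val (tsupport f)).1 ≤ (μ.val W).1 := by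
      refine PosCone.val_le_val_of_coe_le_coe ?_
      rw [coe_val (hμ _ hL), coe_val hμW]
      exact μ.mono hL.measurableSet hW.measurableSet hf.2
    rw [hμ.apply_integral hE hL subset_rfl]
    refine le_trans ?_ (φ.mono hle)
    rw [← hreal, ← integral_indicator_one hL.measurableSet]
    refine integral_mono (integrable_scalarMeasureOn f)
      ((integrable_const 1).indicator hL.measurableSet) fun x => ?_
    by_cases hx : x ∈ tsupport f
    · rw [indicator_of_mem hx]; exact (hf.1 x).2
    · rw [indicator_of_notMem hx, image_eq_zero_of_notMem_tsupport hx]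

/-- A regular Borel measure is determined, as to order, by the integrals of the positive
continuous functions with compact support. -/
theorem IsRegularBorel.le_of_integral_le {μ ν : ExtMeasure X E} (hμ : μ.IsRegularBorel)
    (hν : ν.IsRegularBorel)
    (h : ∀ f : C_c(X, ℝ), 0 ≤ f → hμ.isBorel.integral hE f ≤ hν.isBorel.integral hE f) :
    μ ≤ ν := by
  -- A Urysohn function between `K` and an open `W ⊇ K` gives `μ K ≤ ν W`, and outer regularity of
  -- `ν` passes to `ν K`. Inner regularity of `μ` then extends this to open sets, and outer
  -- regularity of `ν` to Borel sets.
  have hcompact : ∀ K, IsCompact K → μ K ≤ ν K := by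
    refine fun K hK => (hν.outerRegular K hK.measurableSet).2 ?_
    rintro _ ⟨⟨W, hW, hKW⟩, rfl⟩
    change μ K ≤ ν W
    by_cases htop : ν W = ⊤
    · rw [htop]; exact le_top
    obtain ⟨f, hf, hf1⟩ := exists_mem_unitFunctions_eq_one hK hW hKW
    have hf0 : 0 ≤ f := fun x => (hf.1 x).1
    rw [← coe_val (hμ.isBorel K hK), ← coe_val htop]
    exact WithTop.coe_le_coe.2 ((hμ.isBorel.le_integral hE hK hf0 hf1).trans
      ((h f hf0).trans (hν.isBorel.integral_le hE hW htop hf)))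
  have hopen : ∀ V, IsOpen V → μ V ≤ ν V := by
    refine fun V hV => (hμ.innerRegular V hV).2 ?_
    rintro _ ⟨⟨K, hK, hKV⟩, rfl⟩
    exact (hcompact K hK).trans (ν.mono hK.measurableSet hV.measurableSet hKV)
  refine fun s hs => (hν.outerRegular s hs).2 ?_
  rintro _ ⟨⟨V, hV, hsV⟩, rfl⟩
  exact (μ.mono hs hV.measurableSet hsV).trans (hopen V hV)

end ExtMeasure

/-- The integral with respect to the representing measure of `T` is `T`. -/
theorem PositiveLinearMap.integral_representingMeasure [CompleteSpace E]
    (hE : IsOrderContinuousNorm E) (T : C_c(X, ℝ) →ₚ[ℝ] E) (f : C_c(X, ℝ)) :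
    (T.isRegularBorel_representingMeasure hE).isBorel.integral hE f = T f :=
  PosDual.eq_of_forall_eq fun φ => by
    have hK : IsCompact (tsupport f) := f.hasCompactSupport
    rw [ExtMeasure.IsBorel.apply_integral hE _ hK subset_rfl, ← T.scalarize_apply φ,
      ← RealRMK.integral_rieszMeasure (T.scalarize φ) f,
      ← setIntegral_eq_integral_of_forall_compl_eq_zero (s := tsupport f)
        (μ := RealRMK.rieszMeasure (T.scalarize φ))
        fun x hx => image_eq_zero_of_notMem_tsupport hx]
    -- It remains to identify `s ↦ φ (μ (s ∩ tsupport f))` with the Riesz measure restricted to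
    -- `tsupport f`. All sets involved lie in a compact set and therefore have values in `E`.
    congr 1
    ext s hs
    have hf : T.IsFiniteOn (s ∩ tsupport f) := (isFiniteOn_of_isCompact hK).mono inter_subset_right
    obtain ⟨x, hx⟩ := hf.exists_hasValue hE
    rw [ExtMeasure.scalarMeasureOn_apply φ hs, Measure.restrict_apply hs,
      ExtMeasure.val_eq (T.representingMeasure_eq hE (hs.inter hK.measurableSet) hf hx), ← hx φ]

/-- The map from the regular Borel measures to the positive regular operators. -/
noncomputable def regularBorelMeasures.integralMap [CompleteSpace E]
    (hE : IsOrderContinuousNorm E) :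
    regularBorelMeasures X E →ₗ[ℝ≥0] positiveRegularOperators C_c(X, ℝ) E where
  toFun μ := ⟨⟨μ.2.isBorel.integralOperator hE, μ.2.isBorel.integralOperator hE, 0,
    fun _ hf => μ.2.isBorel.integral_nonneg hE hf, fun _ _ => le_rfl, (sub_zero _).symm⟩,
    fun _ hf => μ.2.isBorel.integral_nonneg hE hf⟩
  map_add' μ ν := Subtype.ext (Subtype.ext (LinearMap.ext fun f =>
    μ.2.isBorel.integral_add_measure hE ν.2.isBorel (μ + ν).2.isBorel f))
  map_smul' r μ := Subtype.ext (Subtype.ext (LinearMap.ext fun f =>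
    μ.2.isBorel.integral_smul_measure hE r (r • μ).2.isBorel f))

theorem regularBorelMeasures.integralMap_le_iff [CompleteSpace E] (hE : IsOrderContinuousNorm E)
    (μ ν : regularBorelMeasures X E) : integralMap hE μ ≤ integralMap hE ν ↔ μ ≤ ν :=
  ⟨fun h => ExtMeasure.IsRegularBorel.le_of_integral_le hE μ.2 ν.2 h,
    fun h _ hf => μ.2.isBorel.integral_mono_measure hE ν.2.isBorel h hf⟩

/-- Injectivity follows by antisymmetry from the order embedding; the representing measure of a
positive operator is a preimage. -/
theorem regularBorelMeasures.integralMap_bijective [CompleteSpace E]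
    (hE : IsOrderContinuousNorm E) :
    Function.Bijective (integralMap hE : regularBorelMeasures X E →ₗ[ℝ≥0] _) := by
  refine ⟨fun μ ν h => le_antisymm ((integralMap_le_iff hE μ ν).1 h.le)
    ((integralMap_le_iff hE ν μ).1 h.ge), fun T => ?_⟩
  let T' : C_c(X, ℝ) →ₚ[ℝ] E := PositiveLinearMap.mk₀ T.1.1 fun f hf => T.2 f hf
  exact ⟨⟨T'.representingMeasure hE, T'.isRegularBorel_representingMeasure hE⟩,
    Subtype.ext (Subtype.ext (LinearMap.ext fun f => T'.integral_representingMeasure hE f))⟩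

end IntegralOperator

/-! ### The isomorphism of ordered cones and the decomposition of regular operators -/

theorem mainTheorem4 {X E : Type*}
    [TopologicalSpace X] [LocallyCompactSpace X] [T2Space X] [Nonempty X]
    [MeasurableSpace X] [BorelSpace X]
    [NormedAddCommGroup E] [Lattice E] [IsOrderedAddMonoid E] [HasSolidNorm E]
    [NormedSpace ℝ E] [IsOrderedModule ℝ E] [CompleteSpace E]
    (hE : IsOrderContinuousNorm E) :
    ∃ I : regularBorelMeasures X E ≃ₗ[ℝ≥0] positiveRegularOperators C_c(X, ℝ) E,
      (∀ (μ : regularBorelMeasures X E) (f : C_c(X, ℝ)), μ.1.HasIntegral f ((I μ).1.1 f)) ∧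
      (∀ μ ν : regularBorelMeasures X E, I μ ≤ I ν ↔ μ ≤ ν) ∧
      (∀ T : regularOperators C_c(X, ℝ) E, ∃ μ₁ μ₂ : regularBorelMeasures X E,
        ∀ f : C_c(X, ℝ), T.1 f = (I μ₁).1.1 f - (I μ₂).1.1 f) := by
  let I : regularBorelMeasures X E ≃ₗ[ℝ≥0] positiveRegularOperators C_c(X, ℝ) E :=
    LinearEquiv.ofBijective _ (regularBorelMeasures.integralMap_bijective hE)
  refine ⟨I, fun μ f => μ.2.isBorel.hasIntegral hE f,
    regularBorelMeasures.integralMap_le_iff hE, ?_⟩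
  rintro ⟨_, S₁, S₂, h₁, h₂, rfl⟩
  -- A positive linear map is regular as its difference with `0`, so surjectivity of `I` applies to
  -- each of the two summands.
  have hreg : ∀ S : C_c(X, ℝ) →ₗ[ℝ] E, (∀ f, 0 ≤ f → 0 ≤ S f) →
      ∃ μ : regularBorelMeasures X E, ∀ f, (I μ).1.1 f = S f := by
    intro S hS
    refine ⟨I.symm ⟨⟨S, S, 0, hS, fun _ _ => le_rfl, (sub_zero S).symm⟩, hS⟩, fun f => ?_⟩
    rw [I.apply_symm_apply]
  obtain ⟨μ₁, hμ₁⟩ := hreg S₁ h₁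
  obtain ⟨μ₂, hμ₂⟩ := hreg S₂ h₂
  exact ⟨μ₁, μ₂, fun f => by rw [hμ₁, hμ₂]; rfl⟩
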